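/- Let $N,k\ge 0$ be integers and let $V=\mathbb{C}[X_i^{(j)} : 0\le i\le N,\ j\ge 0]$ be the algebra of differential polynomials in $N+1$ variables. For an integer $m$, let $V^{(m)}\subset V$ be the subalgebra generated by the $X_i^{(j)}$ with $j\le m$ (so $V^{(-1)}=\mathbb{C}$). For an invertible formal series $\alpha\in\mathbb{C}[[T]]^{\times}$ and $P\in V$, let $\alpha\cdot P$ be the differential polynomial obtained from $P$ by substituting, for all $i$ and $j$, \[ X_i^{(j)}\longmapsto \sum_{l=0}^{j}\binom{j}{l}\,\alpha^{(j-l)}(0)\,X_i^{(l)} . \] For $d\ge 0$, let $V_d^{\mathrm{Diff}}=\{P\in V : \alpha\cdot P=\alpha(0)^dP \text{ for all } \alpha\in\mathbb{C}[[T]]^{\times}\}$ be the space of differentially homogeneous polynomials of degree $d$, let $V^{\mathrm{Diff}}=\sum_{d\ge 0}V_d^{\mathrm{Diff}}$, a subalgebra of $V$, and put $(V_d^{\mathrm{Diff}})^{(m)}=V_d^{\mathrm{Diff}}\cap V^{(m)}$ and $(V^{\mathrm{Diff}})^{(m)}=V^{\mathrm{Diff}}\cap V^{(m)}$. Then the $\mathbb{C}$-algebra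 $(V^{\mathrm{Diff}})^{(k)}$ is finitely generated. More precisely, for every choice, for each $1\le i\le k+1$, of a family $\mathcal{B}_i$ of elements of $(V_i^{\mathrm{Diff}})^{(i-1)}$ that induces a basis of the quotient space $(V_i^{\mathrm{Diff}})^{(i-1)}/(V_i^{\mathrm{Diff}})^{(i-2)}$, one has \[ (V^{\mathrm{Diff}})^{(k)}=\mathbb{C}[\mathcal{B}_1,\mathcal{B}_2,\dots,\mathcal{B}_{k+1}], \] the subalgebra of $V$ generated by all the elements of $\mathcal{B}_1,\dots,\mathcal{B}_{k+1}$. -/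

import Mathlib

noncomputable section

namespace DiffHom

/-- The algebra `V = ℂ[X^(0), X^(1), …]` of differential polynomials in `N + 1` variables:
the pair `(i, j)` stands for the formal variable `X_i^(j)`. -/
abbrev V (N : ℕ) : Type := MvPolynomial (Fin (N + 1) × ℕ) ℂ

/-- `V^(k)`: the differential polynomials of order at most `k`, that is, the polynomials in the
variables `X_i^(j)` with `j ≤ k`. The order is an integer, so that `V^(-1)` makes sense: it
consists of the constants. -/
def orderLE (N : ℕ) (k : ℤ) : Subalgebra ℂ (V N) :=
  MvPolynomial.supported ℂ {p : Fin (N + 1) × ℕ | (p.2 : ℤ) ≤ k}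

/-- `α^(m)(0)`, the value at `T = 0` of the `m`-th formal derivative of `α ∈ ℂ[[T]]`. -/
def derivAtZero (α : PowerSeries ℂ) (m : ℕ) : ℂ :=
  PowerSeries.constantCoeff ((PowerSeries.derivative ℂ)^[m] α)

/-- `(α X_i)^(k)` at `T = 0`, by the Leibniz rule:
`∑_{j ≤ k} (k choose j) α^(k-j)(0) X_i^(j)`. -/
def leibniz (N : ℕ) (α : PowerSeries ℂ) (i : Fin (N + 1)) (k : ℕ) : V N :=
  ∑ j ∈ Finset.range (k + 1),
    ((k.choose j : ℂ) * derivAtZero α (k - j)) • MvPolynomial.X (i, j)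

/-- The transformation `P ↦ α · P = P((αX)^(0), (αX)^(1), …)|_{T = 0}` of `V`. -/
def act (N : ℕ) (α : (PowerSeries ℂ)ˣ) : V N →ₐ[ℂ] V N :=
  MvPolynomial.aeval fun p : Fin (N + 1) × ℕ => leibniz N (α : PowerSeries ℂ) p.1 p.2

/-- `V_d^Diff`: the space of differentially homogeneous polynomials of degree `d`, those `P` with
`α · P = α(0)^d P` for every invertible formal series `α`. -/
def VDiff (N d : ℕ) : Submodule ℂ (V N) where
  carrier := {P | ∀ α : (PowerSeries ℂ)ˣ,
    act N α P = (PowerSeries.constantCoeff (α : PowerSeries ℂ)) ^ d • P}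
  add_mem' := by
    intro P Q hP hQ α
    rw [map_add, hP α, hQ α, smul_add]
  zero_mem' := by
    intro α
    rw [map_zero, smul_zero]
  smul_mem' := by
    intro c P hP α
    rw [map_smul, hP α, smul_comm]

/-- `(V_d^Diff)^(k)`: the differentially homogeneous polynomials of degree `d` and order at
most `k`. -/
def VDiffOrder (N d : ℕ) (k : ℤ) : Submodule ℂ (V N) :=
  VDiff N d ⊓ Subalgebra.toSubmodule (orderLE N k)

theorem one_mem_VDiff (N : ℕ) : (1 : V N) ∈ VDiff N 0 := by
  intro α
  rw [map_one, pow_zero, one_smul]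

theorem mul_mem_VDiff (N : ℕ) {d e : ℕ} {P Q : V N} (hP : P ∈ VDiff N d) (hQ : Q ∈ VDiff N e) :
    P * Q ∈ VDiff N (d + e) := by
  intro α
  rw [map_mul, hP α, hQ α, pow_add, smul_mul_smul_comm]

/-- `V^Diff`, the sum of all the `V_d^Diff`, as a subalgebra of `V`. -/
def diffAlgebra (N : ℕ) : Subalgebra ℂ (V N) :=
  Submodule.toSubalgebra (⨆ d : ℕ, VDiff N d)
    (Submodule.mem_iSup_of_mem 0 (one_mem_VDiff N))
    (by
      intro P Q hP hQ
      induction hP using Submodule.iSup_induction' with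
      | mem d P hP =>
        induction hQ using Submodule.iSup_induction' with
        | mem e Q hQ => exact Submodule.mem_iSup_of_mem (d + e) (mul_mem_VDiff N hP hQ)
        | zero => rw [mul_zero]; exact Submodule.zero_mem _
        | add Q R _ _ hQ hR => rw [mul_add]; exact Submodule.add_mem _ hQ hR
      | zero => rw [zero_mul]; exact Submodule.zero_mem _
      | add P R _ _ hP hR => rw [add_mul]; exact Submodule.add_mem _ hP hR)

/-- `(V^Diff)^(k)`: the subalgebra of `V^Diff` of the elements of order at most `k`. -/
def diffAlgebraOrder (N : ℕ) (k : ℤ) : Subalgebra ℂ (V N) :=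
  diffAlgebra N ⊓ orderLE N k

/-- A family `b` in a subspace `W` induces a basis of the quotient of `W` by (its intersection
with) `W'`: the classes of the `b j` are linearly independent and span. -/
def InducesBasis {E : Type*} [AddCommGroup E] [Module ℂ E] (W W' : Submodule ℂ E)
    {ι : Type*} (b : ι → W) : Prop :=
  LinearIndependent ℂ (fun j => (W'.submoduleOf W).mkQ (b j)) ∧
    Submodule.span ℂ (Set.range fun j => (W'.submoduleOf W).mkQ (b j)) = ⊤

end DiffHom

end

/-!
A differentially homogeneous polynomial `P` of degree `d` and order at most `k` is homogeneous of
degree `d`, hence determined by its polarisations along the words `w` of length `d`, which are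
linear functionals on `ℂ[x_1, …, x_d]`. The bound on the order says that these functionals vanish on
the ideal generated by the `x_i ^ (k + 1)`, and the invariance under the series `1 - zT` that they
do not change under multiplication by `∏ (1 - z x_i)`. Together these two properties force them to
vanish on the Tanisaki ideal of the diagram whose columns have length `k + 1`, except for the last
one. The annihilator of this ideal (the harmonics of Garsia and Procesi) is spanned by functionals
dual to the derivatives of the products of Vandermonde determinants of the columns, one for each
filling of the diagram. Recovering `P` from its polarisations turns such a product into a product
of determinants of size at most `k + 1` in the Taylor coefficients of the `X_i`. A determinant of
size `b` is differentially homogeneous of degree `b` and of order at most `b - 1`, so the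
determinants of size at most `k + 1` generate the algebra of order `k`, and an induction on the
degree replaces them by the given families.
-/

noncomputable section

namespace DiffHom

open MvPolynomial
open scoped Nat PowerSeries Polynomial

section CompleteSymmetric

variable {R σ τ : Type*} [CommRing R]

/-- The complete homogeneous symmetric polynomial of degree `r` in the variables `X i`, `i ∈ T`,
defined through its generating series `∏ i ∈ T, 1 / (1 - X i t)`. -/
def hsymmOn (R : Type*) [CommRing R] {σ : Type*} (T : Finset σ) (r : ℕ) : MvPolynomial σ R :=
  PowerSeries.coeff r (∏ i ∈ T, PowerSeries.mk (X i ^ · : ℕ → MvPolynomial σ R))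

theorem hsymmOn_insert [DecidableEq σ] {T : Finset σ} {n : σ} (hn : n ∉ T) (r : ℕ) :
    hsymmOn R (insert n T) r =
      ∑ p ∈ Finset.HasAntidiagonal.antidiagonal r, X n ^ p.1 * hsymmOn R T p.2 := by
  simp only [hsymmOn, Finset.prod_insert hn, PowerSeries.coeff_mul, PowerSeries.coeff_mk]

theorem hsymmOn_singleton (n : σ) (r : ℕ) : hsymmOn R {n} r = X n ^ r := by
  rw [hsymmOn, Finset.prod_singleton, PowerSeries.coeff_mk]

theorem rename_hsymmOn (f : σ ↪ τ) (T : Finset σ) (r : ℕ) :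
    rename f (hsymmOn R T r) = hsymmOn R (T.map f) r := by
  rw [hsymmOn, ← AlgHom.coe_toRingHom, ← PowerSeries.coeff_map, map_prod, hsymmOn,
    Finset.prod_map]
  congr 1
  refine Finset.prod_congr rfl fun i _ => ?_
  ext1 a
  simp only [PowerSeries.coeff_map, PowerSeries.coeff_mk, AlgHom.coe_toRingHom, map_pow, rename_X]

theorem hsymmOn_mem_of_pow_mem {I : Ideal (MvPolynomial σ R)} {k : ℕ}
    (hI : ∀ i, X i ^ (k + 1) ∈ I) {T : Finset σ} {r : ℕ} (hr : T.card * k < r) :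
    hsymmOn R T r ∈ I := by
  classical
  rw [hsymmOn, PowerSeries.coeff_prod]
  refine sum_mem fun l hl => ?_
  obtain ⟨i, hi, hk⟩ : ∃ i ∈ T, k < l i := by
    by_contra! h
    have := Finset.sum_le_card_nsmul T l k h
    rw [(Finset.mem_finsuppAntidiag.mp hl).1, smul_eq_mul] at this
    omega
  refine Ideal.mem_of_dvd I (Finset.dvd_prod_of_mem _ hi) ?_
  rw [PowerSeries.coeff_mk]
  exact Ideal.mem_of_dvd I (pow_dvd_pow _ hk) (hI i)

theorem X_pow_mul_hsymmOn_mem [DecidableEq σ] {I : Ideal (MvPolynomial σ R)} {T : Finset σ} {n : σ}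
    (hn : n ∉ T) {j r : ℕ} (hX : X n ^ (j + 1) ∈ I) (hT : ∀ b, r < b → hsymmOn R T b ∈ I)
    (hnT : hsymmOn R (insert n T) (j + r) ∈ I) : X n ^ j * hsymmOn R T r ∈ I := by
  have hmem : (j, r) ∈ Finset.HasAntidiagonal.antidiagonal (j + r) :=
    Finset.HasAntidiagonal.mem_antidiagonal.mpr rfl
  rw [hsymmOn_insert hn, ← Finset.add_sum_erase _ _ hmem] at hnT
  refine (Ideal.add_mem_iff_left I (sum_mem fun p hp => ?_)).mp hnT
  rw [Finset.mem_erase, Finset.HasAntidiagonal.mem_antidiagonal, Ne, Prod.ext_iff] at hp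
  rcases le_or_gt p.1 j with h | h
  · exact Ideal.mul_mem_left _ _ (hT _ (by omega))
  · exact Ideal.mul_mem_right _ _ (Ideal.mem_of_dvd I (pow_dvd_pow _ h) hX)

theorem mk_pow_mul_one_sub (x : R) :
    PowerSeries.mk (x ^ ·) * (1 - PowerSeries.C x * PowerSeries.X) = 1 := by
  have h := congrArg (PowerSeries.rescale x) (PowerSeries.mk_one_mul_one_sub_eq_one R)
  simpa only [map_mul, map_sub, map_one, PowerSeries.rescale_mk, PowerSeries.rescale_X,
    Pi.one_apply, mul_one] using h

theorem coe_prod_one_sub (x : σ → R) (U : Finset σ) :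
    ((∏ i ∈ U, (1 - Polynomial.C (x i) * Polynomial.X) : R[X]) : R⟦X⟧) =
      ∏ i ∈ U, (1 - PowerSeries.C (x i) * PowerSeries.X) := by
  rw [← Polynomial.coeToPowerSeries.ringHom_apply, map_prod]
  simp only [map_sub, map_mul, map_one, Polynomial.coeToPowerSeries.ringHom_apply,
    Polynomial.coe_C, Polynomial.coe_X]

theorem coeff_prod_one_sub_eq_zero (x : σ → R) {U : Finset σ} {r : ℕ} (hr : U.card < r) :
    (∏ i ∈ U, (1 - Polynomial.C (x i) * Polynomial.X)).coeff r = 0 := by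
  refine Polynomial.coeff_eq_zero_of_natDegree_lt (lt_of_le_of_lt ?_ hr)
  rw [Finset.card_eq_sum_ones]
  refine (Polynomial.natDegree_prod_le _ _).trans (Finset.sum_le_sum fun i _ => ?_)
  compute_degree

theorem hsymmOn_mem_of_coeff_prod_mem {I : Ideal (MvPolynomial σ R)} {T U : Finset σ}
    (hTU : T ⊆ U)
    (hI : ∀ s ≠ 0,
      (∏ i ∈ U, (1 - Polynomial.C (X i : MvPolynomial σ R) * Polynomial.X)).coeff s ∈ I)
    {r : ℕ} (hr : U.card < r + T.card) : hsymmOn R T r ∈ I := by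
  classical
  let π := Ideal.Quotient.mk I
  set Q := ∏ i ∈ U, (1 - Polynomial.C (X i : MvPolynomial σ R) * Polynomial.X) with hQ
  set E := ∏ i ∈ U \ T, (1 - Polynomial.C (X i : MvPolynomial σ R) * Polynomial.X) with hE
  have hmul : (∏ i ∈ T, PowerSeries.mk (X i ^ · : ℕ → MvPolynomial σ R)) * Q = E := by
    rw [hQ, hE, coe_prod_one_sub, coe_prod_one_sub, ← Finset.prod_sdiff hTU, mul_left_comm,
      ← Finset.prod_mul_distrib]
    simp only [mk_pow_mul_one_sub, Finset.prod_const_one, mul_one]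
  have hQ1 : PowerSeries.map π Q = 1 := by
    ext s
    rw [PowerSeries.coeff_map, Polynomial.coeff_coe, PowerSeries.coeff_one]
    split_ifs with hs
    · rw [hs, hQ, Polynomial.coeff_zero_prod]
      simp
    · exact Ideal.Quotient.eq_zero_iff_mem.mpr (hI s hs)
  have hEr : E.coeff r = 0 := by
    refine coeff_prod_one_sub_eq_zero _ ?_
    have := Finset.card_sdiff_add_card_eq_card hTU
    omega
  rw [← Ideal.Quotient.eq_zero_iff_mem, hsymmOn, ← PowerSeries.coeff_map,
    ← mul_one (PowerSeries.map _ _), ← hQ1, ← map_mul, hmul, PowerSeries.coeff_map,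
    Polynomial.coeff_coe, hEr, map_zero]

end CompleteSymmetric

section AnnIdeal

variable {R A : Type*} [CommRing R] [CommRing A] [Algebra R A]

/-- The largest ideal of `A` contained in the kernel of the linear functional `F`. -/
def annIdeal (F : Module.Dual R A) : Ideal A where
  carrier := {g | ∀ f, F (f * g) = 0}
  add_mem' ha hb f := by rw [mul_add, map_add, ha, hb, add_zero]
  zero_mem' f := by rw [mul_zero, map_zero]
  smul_mem' c g hg f := by rw [smul_eq_mul, ← mul_assoc, hg]

theorem mem_annIdeal {F : Module.Dual R A} {g : A} : g ∈ annIdeal F ↔ ∀ f, F (f * g) = 0 :=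
  Iff.rfl

/-- The space of the linear functionals that vanish on the ideal `I`. -/
def idealAnnihilator (R : Type*) {A : Type*} [CommRing R] [CommRing A] [Algebra R A]
    (I : Ideal A) : Submodule R (Module.Dual R A) :=
  (I.restrictScalars R).dualAnnihilator

theorem mem_idealAnnihilator_iff_le {I : Ideal A} {F : Module.Dual R A} :
    F ∈ idealAnnihilator R I ↔ I ≤ annIdeal F := by
  rw [idealAnnihilator, Submodule.mem_dualAnnihilator]
  exact ⟨fun h g hg f => h _ (I.mul_mem_left f hg), fun h g hg => by simpa using h hg 1⟩

theorem mem_idealAnnihilator_span_iff {s : Set A} {F : Module.Dual R A} :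
    F ∈ idealAnnihilator R (Ideal.span s) ↔ s ⊆ annIdeal F := by
  rw [mem_idealAnnihilator_iff_le, Ideal.span_le]

variable [IsDomain R] [Infinite R]

theorem coeff_mem_annIdeal {F : Module.Dual R A} {Q : A[X]}
    (hF : ∀ (z : R) (g : A), F (g * Q.eval (algebraMap R A z)) = F g) {s : ℕ} (hs : s ≠ 0) :
    Q.coeff s ∈ annIdeal F := by
  intro g
  -- The polynomial function `z ↦ F (g * Q(z))` is constant, hence so is the polynomial.
  have sum_monomial_eq_C : ∑ s ∈ Q.support, Polynomial.monomial s (F (g * Q.coeff s)) =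
      Polynomial.C (F g) := by
    refine Polynomial.funext fun z => ?_
    rw [Polynomial.eval_finsetSum, Polynomial.eval_C, ← hF z g, Polynomial.eval_eq_sum,
      Polynomial.sum, Finset.mul_sum, map_sum]
    refine Finset.sum_congr rfl fun s _ => ?_
    rw [Polynomial.eval_monomial, ← map_pow, ← mul_assoc, mul_comm _ (algebraMap R A _),
      ← Algebra.smul_def, map_smul, smul_eq_mul, mul_comm]
  by_cases h : s ∈ Q.support
  · simpa only [Polynomial.finsetSum_coeff, Polynomial.coeff_monomial, Finset.sum_ite_eq', h,
      if_true, Polynomial.coeff_C, hs, if_false]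
      using congrArg (Polynomial.coeff · s) sum_monomial_eq_C
  · rw [Polynomial.notMem_support_iff.mp h, mul_zero, map_zero]

theorem hsymmOn_mem_annIdeal_of_invariant {σ : Type*} {F : Module.Dual R (MvPolynomial σ R)}
    {T U : Finset σ} (hTU : T ⊆ U)
    (hF : ∀ (z : R) (g : MvPolynomial σ R), F (g * ∏ i ∈ U, (1 - C z * X i)) = F g)
    {r : ℕ} (hr : U.card < r + T.card) : hsymmOn R T r ∈ annIdeal F := by
  refine hsymmOn_mem_of_coeff_prod_mem hTU (fun s hs => coeff_mem_annIdeal (fun z g => ?_) hs) hr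
  simp only [Polynomial.eval_prod, Polynomial.eval_sub, Polynomial.eval_one, Polynomial.eval_mul,
    Polynomial.eval_C, Polynomial.eval_X, algebraMap_eq, mul_comm (X _), hF]

end AnnIdeal

section Cell

/-- The cells `(c, κ)`, `κ < β c`, of the diagram whose `c`-th column has length `β c`. -/
abbrev Cell (β : ℕ → ℕ) : Type := {p : ℕ × ℕ // p.2 < β p.1}

variable {β : ℕ → ℕ} {c : ℕ}

/-- The column lengths of the diagram `β` without the bottom cell of its `c`-th column. -/
def removeCell (β : ℕ → ℕ) (c : ℕ) : ℕ → ℕ :=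
  Function.update β c (β c - 1)

theorem antitone_removeCell (hβ : Antitone β) (hc : β (c + 1) < β c) :
    Antitone (removeCell β c) := by
  intro a b hab
  have h1 := hβ hab
  have h2 : a < b → β b ≤ β (a + 1) := fun h => hβ h
  simp only [removeCell, Function.update_apply]
  split_ifs with hb ha ha
  · exact le_rfl
  · subst hb
    omega
  · subst ha
    have := h2 (by omega)
    omega
  · exact h1

theorem sum_range_removeCell_of_le {t : ℕ} (ht : t ≤ c) :
    ∑ i ∈ Finset.range t, removeCell β c i = ∑ i ∈ Finset.range t, β i :=
  Finset.sum_update_of_notMem (by simpa using ht) _ _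

theorem sum_range_removeCell_add_one {t : ℕ} (ht : c < t) (hc : 0 < β c) :
    ∑ i ∈ Finset.range t, removeCell β c i + 1 = ∑ i ∈ Finset.range t, β i := by
  have hm : c ∈ Finset.range t := Finset.mem_range.mpr ht
  rw [removeCell, Finset.sum_update_of_mem hm, ← Finset.add_sum_erase _ _ hm,
    Finset.sdiff_singleton_eq_erase]
  omega

theorem exists_column_eq_last [Finite (Cell β)] {j : ℕ} (h0 : j < β 0) :
    ∃ c, j < β c ∧ β (c + 1) ≤ j := by
  by_contra! h
  have hj : ∀ c, j < β c := Nat.rec h0 h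
  have : Function.Injective fun c => (⟨(c, j), hj c⟩ : Cell β) := fun c c' hcc' =>
    congrArg (fun q : Cell β => q.1.1) hcc'
  exact not_finite_iff_infinite.mpr (Infinite.of_injective _ this) inferInstance

theorem sum_le_sum_range_card_of_antitone (hβ : Antitone β) (S : Finset ℕ) :
    ∑ c ∈ S, β c ≤ ∑ c ∈ Finset.range S.card, β c := by
  induction S using Finset.induction_on_max with
  | empty => simp
  | insert a S ha ih =>
    have hn : a ∉ S := fun h => lt_irrefl _ (ha a h)
    have hc : S.card ≤ a := by
      have : S ⊆ Finset.range a := fun x hx => Finset.mem_range.mpr (ha x hx)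
      simpa using Finset.card_le_card this
    rw [Finset.sum_insert hn, Finset.card_insert_of_notMem hn, Finset.sum_range_succ, add_comm]
    exact add_le_add ih (hβ hc)

theorem lt_removeCell_iff {p : ℕ × ℕ} :
    p.2 < removeCell β c p.1 ↔ p.2 < β p.1 ∧ p ≠ (c, β c - 1) := by
  obtain ⟨a, κ⟩ := p
  rw [removeCell, Function.update_apply, Ne, Prod.mk.injEq]
  split_ifs with h
  · subst h
    simp only [true_and]
    omega
  · simp only [h, false_and, not_false_eq_true, and_true]

/-- The diagram `β` consists of the bottom cell of its `c`-th column and of the cells of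
`removeCell β c`. -/
def optionCellEquiv (hc : 0 < β c) : Option (Cell (removeCell β c)) ≃ Cell β :=
  (Equiv.optionCongr
    { toFun := fun p => ⟨⟨p.1, (lt_removeCell_iff.mp p.2).1⟩, fun h =>
        (lt_removeCell_iff.mp p.2).2 (congrArg Subtype.val h)⟩
      invFun := fun p => ⟨p.1.1, lt_removeCell_iff.mpr ⟨p.1.2, fun h => p.2 (Subtype.ext h)⟩⟩
      left_inv := fun _ => rfl
      right_inv := fun _ => rfl }).trans
  (Equiv.optionSubtypeNe (⟨(c, β c - 1), Nat.sub_lt hc one_pos⟩ : Cell β))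

variable {n : ℕ}

/-- The numbering of `β` that extends a numbering of `removeCell β c` by giving the largest number
to the removed cell. -/
def snocCell (hc : 0 < β c) (e : Fin n ≃ Cell (removeCell β c)) : Fin (n + 1) ≃ Cell β :=
  finSuccEquivLast.trans (e.optionCongr.trans (optionCellEquiv hc))

theorem snocCell_castSucc (hc : 0 < β c) (e : Fin n ≃ Cell (removeCell β c)) (i : Fin n) :
    (snocCell hc e i.castSucc).1 = (e i).1 := by
  simp [snocCell, optionCellEquiv]

theorem snocCell_last (hc : 0 < β c) (e : Fin n ≃ Cell (removeCell β c)) :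
    (snocCell hc e (Fin.last n)).1 = (c, β c - 1) := by
  simp [snocCell, optionCellEquiv]

/-- The numbering of `removeCell β c` induced by a numbering of `β`: the cell with the largest
number takes the number of the removed cell. -/
def removeCellEquiv (hc : 0 < β c) (e : Fin (n + 1) ≃ Cell β) : Fin n ≃ Cell (removeCell β c) :=
  (finSuccEquivLast.symm.trans (e.trans (optionCellEquiv hc).symm)).removeNone

end Cell

section BlockMatrix

variable {ι R : Type*} [CommRing R] {β : ℕ → ℕ} {b : ℕ}

/-- The square matrix whose `i`-th row lists the first coefficients of the series `f i`. -/
def coeffMatrix (f : Fin b → R⟦X⟧) : Matrix (Fin b) (Fin b) R :=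
  Matrix.of fun i j => PowerSeries.coeff (j : ℕ) (f i)

theorem map_coeffMatrix {S : Type*} [CommRing S] (ψ : R →+* S) (f : Fin b → R⟦X⟧) :
    ψ.mapMatrix (coeffMatrix f) = coeffMatrix fun i => PowerSeries.map ψ (f i) := by
  ext i j
  simp only [coeffMatrix, RingHom.mapMatrix_apply, Matrix.map_apply, Matrix.of_apply,
    PowerSeries.coeff_map]

/-- The matrix of the multiplication by `α` on series truncated at `T ^ b`. -/
def toeplitz (b : ℕ) (α : R⟦X⟧) : Matrix (Fin b) (Fin b) R :=
  Matrix.of fun i j => if i ≤ j then PowerSeries.coeff (j - i : ℕ) α else 0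

theorem det_toeplitz (α : R⟦X⟧) :
    (toeplitz b α).det = PowerSeries.constantCoeff α ^ b := by
  have h : (toeplitz b α).IsUpperTriangular := fun i j hij => if_neg (not_le.mpr hij)
  rw [Matrix.det_of_isUpperTriangular h]
  simp [toeplitz]

theorem coeffMatrix_mul (f : Fin b → R⟦X⟧) (α : R⟦X⟧) :
    (coeffMatrix fun i => f i * α) = coeffMatrix f * toeplitz b α := by
  ext i j
  simp only [coeffMatrix, toeplitz, Matrix.mul_apply, Matrix.of_apply, Fin.le_def,
    PowerSeries.coeff_mul, Finset.Nat.sum_antidiagonal_eq_sum_range_succ_mk]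
  rw [Fin.sum_univ_eq_sum_range fun l => PowerSeries.coeff l (f i) *
    if l ≤ j then PowerSeries.coeff (j - l : ℕ) α else 0]
  have hsub : Finset.range (j + 1) ⊆ Finset.range b := Finset.range_subset_range.mpr j.2
  refine (Finset.sum_congr rfl fun l hl => ?_).trans (Finset.sum_subset hsub fun l _ hl => ?_)
  · rw [if_pos (Nat.lt_succ_iff.mp (Finset.mem_range.mp hl))]
  · rw [if_neg (fun h => hl (Finset.mem_range.mpr (Nat.lt_succ_of_le h))), mul_zero]

theorem det_coeffMatrix_mul (f : Fin b → R⟦X⟧) (α : R⟦X⟧) :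
    (coeffMatrix fun i => f i * α).det =
      (coeffMatrix f).det * PowerSeries.constantCoeff α ^ b := by
  rw [coeffMatrix_mul, Matrix.det_mul, det_toeplitz]

/-- The matrix attached to series `f i`, `i : ι`, and to a numbering `e` of a diagram: both the
rows and the columns are indexed by `ι`, and the `i`-th row lists the coefficients of `f i` along
the cells of the diagram lying in the column of `e i`. -/
def blockMatrix (e : ι ≃ Cell β) (f : ι → R⟦X⟧) : Matrix ι ι R :=
  Matrix.of fun i j =>
    if (e i).1.1 = (e j).1.1 then PowerSeries.coeff (e j).1.2 (f i) else 0

theorem blockMatrix_apply (e : ι ≃ Cell β) (f : ι → R⟦X⟧) (i j : ι) :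
    blockMatrix e f i j =
      if (e i).1.1 = (e j).1.1 then PowerSeries.coeff (e j).1.2 (f i) else 0 := rfl

theorem map_blockMatrix {S : Type*} [CommRing S] [Fintype ι] [DecidableEq ι]
    (ψ : R →+* S) (e : ι ≃ Cell β) (f : ι → R⟦X⟧) :
    ψ.mapMatrix (blockMatrix e f) = blockMatrix e fun i => PowerSeries.map ψ (f i) := by
  ext i j
  simp only [blockMatrix_apply, RingHom.mapMatrix_apply, Matrix.map_apply, apply_ite ψ,
    map_zero, PowerSeries.coeff_map]

/-- The indices that a numbering sends to the `c`-th column, in the order of the cells. -/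
def columnEquiv (e : ι ≃ Cell β) (c : ℕ) : Fin (β c) ≃ {i // (e i).1.1 = c} where
  toFun κ := ⟨e.symm ⟨(c, κ), κ.2⟩, by rw [Equiv.apply_symm_apply]⟩
  invFun i := ⟨(e i).1.2, by
    have h := (e i).2
    rwa [i.2] at h⟩
  left_inv κ := by simp
  right_inv := by
    rintro ⟨i, rfl⟩
    simp

variable [Fintype ι] [DecidableEq ι]

theorem det_blockMatrix (e : ι ≃ Cell β) (f : ι → R⟦X⟧) :
    (blockMatrix e f).det =
      ∏ c ∈ Finset.univ.image fun i => (e i).1.1,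
        (coeffMatrix fun κ => f (columnEquiv e c κ)).det := by
  have h : (blockMatrix e f).BlockTriangular fun i => (e i).1.1 := fun i j hij => if_neg hij.ne'
  rw [h.det]
  refine Finset.prod_congr rfl fun c _ => ?_
  rw [← Matrix.det_submatrix_equiv_self (columnEquiv e c)]
  congr 1
  ext κ l
  simp [Matrix.toSquareBlock_def, blockMatrix_apply, coeffMatrix, columnEquiv]

theorem det_blockMatrix_mul (e : ι ≃ Cell β) (f : ι → R⟦X⟧) {α : ℕ → R⟦X⟧}
    (hα : ∀ c, PowerSeries.constantCoeff (α c) = 1) :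
    (blockMatrix e fun i => f i * α (e i).1.1).det = (blockMatrix e f).det := by
  rw [det_blockMatrix, det_blockMatrix]
  refine Finset.prod_congr rfl fun c _ => ?_
  have hcol : ∀ κ, (e (columnEquiv e c κ)).1.1 = c := fun κ => (columnEquiv e c κ).2
  simp only [hcol, det_coeffMatrix_mul, hα, one_pow, mul_one]

theorem det_blockMatrix_eq_zero (e : ι ≃ Cell β) {f : ι → R⟦X⟧} {i : ι}
    (hi : PowerSeries.X ^ β (e i).1.1 ∣ f i) : (blockMatrix e f).det = 0 := by
  refine Matrix.det_eq_zero_of_row_eq_zero i fun j => ?_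
  rw [blockMatrix_apply]
  split_ifs with hij
  · exact PowerSeries.X_pow_dvd_iff.mp hi _ (hij ▸ (e j).2)
  · rfl

theorem det_blockMatrix_snoc {n c : ℕ} (hc : 0 < β c) (e : Fin n ≃ Cell (removeCell β c))
    (f : Fin n → R⟦X⟧) :
    (blockMatrix (snocCell hc e)
      (Fin.snoc f (PowerSeries.X ^ (β c - 1)) : Fin (n + 1) → R⟦X⟧)).det =
      (blockMatrix e f).det := by
  rw [Matrix.det_succ_row _ (Fin.last n), Fin.sum_univ_castSucc, Finset.sum_eq_zero, zero_add]
  · simp only [blockMatrix_apply, if_true, snocCell_last, Fin.snoc_last,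
      PowerSeries.coeff_X_pow_self, ← two_mul, (even_two_mul _).neg_one_pow, one_mul]
    congr 1
    ext i j
    simp [blockMatrix_apply, snocCell_castSucc]
  · intro i _
    rw [blockMatrix_apply, snocCell_last, snocCell_castSucc, Fin.snoc_last, PowerSeries.coeff_X_pow]
    have h := lt_removeCell_iff.mp (e i).2
    have : ¬ (c = (e i).1.1 ∧ (e i).1.2 = β c - 1) := fun h' => h.2 (Prod.ext h'.1.symm h'.2)
    rw [← ite_and, if_neg this, mul_zero, zero_mul]

end BlockMatrix

section OfMultilinear

variable {R ι M : Type*} [CommRing R] [Fintype ι] [AddCommGroup M] [Module R M]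

theorem prod_X_pow_eq_prod_aeval (m : ι → ℕ) : (∏ i, X i ^ m i : MvPolynomial ι R) =
    ∏ i, Polynomial.aeval (X i) (Polynomial.X ^ m i : R[X]) := by
  simp only [map_pow, Polynomial.aeval_X]

theorem monomial_one_eq_prod_aeval (m : ι →₀ ℕ) :
    monomial m (1 : R) = ∏ i, Polynomial.aeval (X i) (Polynomial.X ^ m i : R[X]) := by
  rw [← prod_X_pow_eq_prod_aeval, monomial_eq, map_one, one_mul]
  exact Finsupp.prod_fintype _ _ fun i => pow_zero _

theorem linearMap_ext_prod_aeval {F G : MvPolynomial ι R →ₗ[R] M}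
    (h : ∀ p : ι → R[X], F (∏ i, Polynomial.aeval (X i) (p i)) =
      G (∏ i, Polynomial.aeval (X i) (p i))) : F = G := by
  refine (basisMonomials ι R).ext fun m => ?_
  simp only [coe_basisMonomials, monomial_one_eq_prod_aeval, h]

/-- The linear map on polynomials in the variables `X i` that takes the value `Φ p` at the product
of the univariate polynomials `p i (X i)`. -/
def ofMultilinear (Φ : MultilinearMap R (fun _ : ι => R[X]) M) : MvPolynomial ι R →ₗ[R] M :=
  (basisMonomials ι R).constr R fun m => Φ fun i => Polynomial.X ^ m i

theorem ofMultilinear_prod_aeval (Φ : MultilinearMap R (fun _ : ι => R[X]) M) (p : ι → R[X]) :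
    ofMultilinear Φ (∏ i, Polynomial.aeval (X i) (p i)) = Φ p := by
  have h : (ofMultilinear Φ).compMultilinearMap
      ((MultilinearMap.mkPiAlgebra R ι (MvPolynomial ι R)).compLinearMap
        fun i => (Polynomial.aeval (X i)).toLinearMap) = Φ := by
    refine Module.Basis.ext_multilinear (fun _ => Polynomial.basisMonomials R) fun m => ?_
    have hm := monomial_one_eq_prod_aeval (R := R) (Finsupp.equivFunOnFinite.symm m)
    simp only [Finsupp.equivFunOnFinite_symm_apply_apply] at hm
    simp only [LinearMap.compMultilinearMap_apply, MultilinearMap.compLinearMap_apply,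
      MultilinearMap.mkPiAlgebra_apply, Polynomial.coe_basisMonomials, AlgHom.toLinearMap_apply,
      Polynomial.monomial_one_right_eq_X_pow]
    rw [← hm]
    exact (basisMonomials ι R).constr_basis R _ (Finsupp.equivFunOnFinite.symm m)
  exact congrArg (fun Ψ : MultilinearMap R (fun _ : ι => R[X]) M => Ψ p) h

theorem prod_aeval_mulSingle [DecidableEq ι] (l : ι) (q : R[X]) :
    ∏ i, Polynomial.aeval (X i : MvPolynomial ι R) ((Pi.mulSingle l q : ι → R[X]) i) =
      Polynomial.aeval (X l) q := by
  rw [Finset.prod_eq_single l (fun i _ hi => by rw [Pi.mulSingle_eq_of_ne hi, map_one])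
    (fun h => absurd (Finset.mem_univ l) h), Pi.mulSingle_eq_same]

end OfMultilinear

section FillingFunctional

variable {R ι : Type*} [CommRing R] [Fintype ι] [DecidableEq ι] {β : ℕ → ℕ}

/-- The functional attached to a numbering `e` of a diagram and to exponents `a`. Up to a constant,
it is dual, for the apolar pairing, to the partial derivative with exponents `a` of the product of
the Vandermonde determinants of the columns. -/
def fillingFunctional (R : Type*) [CommRing R] (e : ι ≃ Cell β) (a : ι → ℕ) :
    Module.Dual R (MvPolynomial ι R) :=
  ofMultilinear <| Matrix.detRowAlternating.toMultilinearMap.compLinearMap fun i =>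
    LinearMap.pi fun j => if (e i).1.1 = (e j).1.1 then
      Polynomial.lcoeff R (e j).1.2 ∘ₗ LinearMap.mulLeft R (Polynomial.X ^ a i) else 0

theorem fillingFunctional_prod_aeval (e : ι ≃ Cell β) (a : ι → ℕ) (p : ι → R[X]) :
    fillingFunctional R e a (∏ i, Polynomial.aeval (X i) (p i)) =
      (blockMatrix e fun i => PowerSeries.X ^ a i * (p i : R⟦X⟧)).det := by
  rw [fillingFunctional, ofMultilinear_prod_aeval]
  refine congrArg Matrix.det (Matrix.ext fun i j => ?_)
  rw [blockMatrix_apply, ← Polynomial.coe_X, ← Polynomial.coe_pow, ← Polynomial.coe_mul,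
    Polynomial.coeff_coe]
  split_ifs <;> simp_all

/-- Multiplying by `∏ (1 - z X i)` over a union of columns multiplies the series of a column by a
common factor. -/
theorem fillingFunctional_mul_prod_one_sub (e : ι ≃ Cell β) (a : ι → ℕ) (S : Finset ℕ) (z : R)
    (g : MvPolynomial ι R) :
    fillingFunctional R e a (g * ∏ i with (e i).1.1 ∈ S, (1 - C z * X i)) =
      fillingFunctional R e a g := by
  let α : ℕ → R[X] := fun c => if c ∈ S then 1 - Polynomial.C z * Polynomial.X else 1
  have hα : ∏ i with (e i).1.1 ∈ S, (1 - C z * X i : MvPolynomial ι R) =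
      ∏ i, Polynomial.aeval (X i) (α (e i).1.1) := by
    rw [Finset.prod_filter]
    refine Finset.prod_congr rfl fun i _ => ?_
    simp only [α]
    split_ifs <;> simp [algebraMap_eq]
  suffices h : fillingFunctional R e a ∘ₗ LinearMap.mulRight R
      (∏ i with (e i).1.1 ∈ S, (1 - C z * X i)) = fillingFunctional R e a from
    LinearMap.congr_fun h g
  refine linearMap_ext_prod_aeval fun p => ?_
  rw [LinearMap.comp_apply, LinearMap.mulRight_apply, hα, ← Finset.prod_mul_distrib]
  simp only [← map_mul, fillingFunctional_prod_aeval, Polynomial.coe_mul, ← mul_assoc]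
  refine det_blockMatrix_mul e _ (α := fun c => (α c : R⟦X⟧)) fun c => ?_
  simp only [α]
  split_ifs <;> simp

theorem X_pow_mem_annIdeal_fillingFunctional (e : ι ≃ Cell β) (a : ι → ℕ) {l : ι} {s : ℕ}
    (hs : β (e l).1.1 ≤ a l + s) : X l ^ s ∈ annIdeal (fillingFunctional R e a) := by
  rw [mem_annIdeal]
  suffices h : fillingFunctional R e a ∘ₗ LinearMap.mulRight R (X l ^ s) = 0 from
    LinearMap.congr_fun h
  have hl : (X l ^ s : MvPolynomial ι R) = ∏ i, Polynomial.aeval (X i)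
      ((Pi.mulSingle l (Polynomial.X ^ s) : ι → R[X]) i) := by
    rw [prod_aeval_mulSingle, map_pow, Polynomial.aeval_X]
  refine linearMap_ext_prod_aeval fun p => ?_
  rw [LinearMap.comp_apply, LinearMap.mulRight_apply, hl, ← Finset.prod_mul_distrib]
  simp only [← map_mul, fillingFunctional_prod_aeval, LinearMap.zero_apply]
  refine det_blockMatrix_eq_zero e (i := l) ?_
  rw [Pi.mulSingle_eq_same, Polynomial.coe_mul, Polynomial.coe_pow, Polynomial.coe_X]
  refine (pow_dvd_pow _ hs).trans ?_
  rw [pow_add]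
  exact mul_dvd_mul_left _ (dvd_mul_left _ _)

theorem fillingFunctional_snocCell {n c j : ℕ} (hj : j < β c) (e : Fin n ≃ Cell (removeCell β c))
    (a : Fin n → ℕ) (g : MvPolynomial (Fin n) R) :
    fillingFunctional R (snocCell (Nat.zero_lt_of_lt hj) e)
        (Fin.snoc a (β c - 1 - j) : Fin (n + 1) → ℕ)
        (X (Fin.last n) ^ j * rename Fin.castSucc g) =
      fillingFunctional R e a g := by
  suffices h : fillingFunctional R (snocCell (Nat.zero_lt_of_lt hj) e)
        (Fin.snoc a (β c - 1 - j) : Fin (n + 1) → ℕ) ∘ₗ LinearMap.mulLeft R (X (Fin.last n) ^ j) ∘ₗ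
      (rename Fin.castSucc).toLinearMap = fillingFunctional R e a from
    LinearMap.congr_fun h g
  refine linearMap_ext_prod_aeval fun p => ?_
  have hp : (X (Fin.last n) ^ j * rename Fin.castSucc (∏ i, Polynomial.aeval (X i) (p i)) :
      MvPolynomial (Fin (n + 1)) R) = ∏ i, Polynomial.aeval (X i)
        ((Fin.snoc p (Polynomial.X ^ j) : Fin (n + 1) → R[X]) i) := by
    rw [Fin.prod_univ_castSucc, map_prod, mul_comm]
    simp [← Polynomial.aeval_algHom_apply]
  rw [LinearMap.comp_apply, LinearMap.comp_apply, LinearMap.mulLeft_apply,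
    AlgHom.toLinearMap_apply, hp, fillingFunctional_prod_aeval, fillingFunctional_prod_aeval,
    ← det_blockMatrix_snoc (Nat.zero_lt_of_lt hj)]
  congr 2
  funext i
  refine Fin.lastCases ?_ (fun i => ?_) i
  · simp [← pow_add, Nat.sub_add_cancel (Nat.le_sub_one_of_lt hj)]
  · simp

end FillingFunctional

section Tanisaki

variable {R ι : Type*} [CommRing R] {β : ℕ → ℕ}

/-- The Tanisaki ideal of the diagram with columns of length `β c`, generated by the complete
homogeneous symmetric polynomials of too large a degree in a subset of the variables. -/
def tanisakiIdeal (R ι : Type*) [CommRing R] (β : ℕ → ℕ) : Ideal (MvPolynomial ι R) :=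
  Ideal.span {p | ∃ (T : Finset ι) (r : ℕ),
    ∑ c ∈ Finset.range T.card, β c < r + T.card ∧ hsymmOn R T r = p}

theorem mem_idealAnnihilator_tanisakiIdeal {F : Module.Dual R (MvPolynomial ι R)} :
    F ∈ idealAnnihilator R (tanisakiIdeal R ι β) ↔ ∀ (T : Finset ι) (r : ℕ),
      ∑ c ∈ Finset.range T.card, β c < r + T.card → hsymmOn R T r ∈ annIdeal F := by
  rw [tanisakiIdeal, mem_idealAnnihilator_span_iff]
  refine ⟨fun h T r hr => h ⟨T, r, hr, rfl⟩, ?_⟩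
  rintro h _ ⟨T, r, hr, rfl⟩
  exact h T r hr

variable {n c j : ℕ}

/-- The functional `g ↦ F (X (last n) ^ j * g)` on polynomials in the first `n` variables. -/
def lastCoeff (R : Type*) [CommRing R] (n j : ℕ) :
    Module.Dual R (MvPolynomial (Fin (n + 1)) R) →ₗ[R] Module.Dual R (MvPolynomial (Fin n) R) :=
  (LinearMap.mulLeft R (X (Fin.last n) ^ j) ∘ₗ (rename Fin.castSucc).toLinearMap).dualMap

theorem lastCoeff_apply (F : Module.Dual R (MvPolynomial (Fin (n + 1)) R))
    (g : MvPolynomial (Fin n) R) :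
    lastCoeff R n j F g = F (X (Fin.last n) ^ j * rename Fin.castSucc g) := rfl

theorem mem_annIdeal_lastCoeff {F : Module.Dual R (MvPolynomial (Fin (n + 1)) R)}
    {g : MvPolynomial (Fin n) R}
    (h : X (Fin.last n) ^ j * rename Fin.castSucc g ∈ annIdeal F) :
    g ∈ annIdeal (lastCoeff R n j F) := by
  intro f
  rw [lastCoeff_apply, map_mul (rename (R := R) Fin.castSucc), mul_left_comm]
  exact h _

theorem X_last_pow_mem_annIdeal_of_lastCoeff_eq_zero
    {F : Module.Dual R (MvPolynomial (Fin (n + 1)) R)}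
    (hF : X (Fin.last n) ^ (j + 1) ∈ annIdeal F) (h0 : lastCoeff R n j F = 0) :
    X (Fin.last n) ^ j ∈ annIdeal F := by
  rw [mem_annIdeal]
  suffices h : F ∘ₗ LinearMap.mulRight R (X (Fin.last n) ^ j) = 0 from LinearMap.congr_fun h
  refine linearMap_ext_prod_aeval fun p => ?_
  set q := p (Fin.last n)
  have hq : Polynomial.aeval (X (Fin.last n)) q = Polynomial.aeval (X (Fin.last n)) q.divX *
      X (Fin.last n) + (C (q.coeff 0) : MvPolynomial (Fin (n + 1)) R) := by
    conv_lhs => rw [← Polynomial.divX_mul_X_add q]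
    simp [algebraMap_eq]
  have hprod : (∏ i, Polynomial.aeval (X i) (p i)) * X (Fin.last n) ^ j =
      ((∏ i : Fin n, Polynomial.aeval (X i.castSucc) (p i.castSucc)) *
        Polynomial.aeval (X (Fin.last n)) q.divX) * X (Fin.last n) ^ (j + 1) +
      X (Fin.last n) ^ j * rename Fin.castSucc
        (C (q.coeff 0) * ∏ i : Fin n, Polynomial.aeval (X i) (p i.castSucc)) := by
    rw [Fin.prod_univ_castSucc, hq, map_mul, map_prod, rename_C]
    simp only [← Polynomial.aeval_algHom_apply, rename_X]
    ring
  rw [LinearMap.comp_apply, LinearMap.mulRight_apply, LinearMap.zero_apply, hprod, map_add, hF,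
    ← lastCoeff_apply, h0, LinearMap.zero_apply, add_zero]

theorem lastCoeff_mem_idealAnnihilator_tanisakiIdeal (hβ : Antitone β) (hc : j < β c)
    (hc' : β (c + 1) ≤ j) {F : Module.Dual R (MvPolynomial (Fin (n + 1)) R)}
    (hF : F ∈ idealAnnihilator R (tanisakiIdeal R (Fin (n + 1)) β))
    (hFj : X (Fin.last n) ^ (j + 1) ∈ annIdeal F) :
    lastCoeff R n j F ∈ idealAnnihilator R (tanisakiIdeal R (Fin n) (removeCell β c)) := by
  rw [mem_idealAnnihilator_tanisakiIdeal] at hF ⊢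
  intro T r hr
  set T' := T.map Fin.castSuccEmb with hT'
  have hcard : T'.card = T.card := Finset.card_map _
  have hlast : Fin.last n ∉ T' := by simp [hT', Fin.castSucc_ne_last]
  refine mem_annIdeal_lastCoeff ?_
  rw [show rename Fin.castSucc (hsymmOn R T r) = hsymmOn R T' r from
    rename_hsymmOn Fin.castSuccEmb T r]
  by_cases hlt : ∑ i ∈ Finset.range T'.card, β i < r + T'.card
  · exact Ideal.mul_mem_left _ _ (hF T' r hlt)
  have hct : c < T.card := by
    by_contra hct
    rw [sum_range_removeCell_of_le (by omega)] at hr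
    exact hlt (by rwa [hcard])
  have hsum := sum_range_removeCell_add_one hct (Nat.zero_lt_of_lt hc)
  refine X_pow_mul_hsymmOn_mem hlast hFj (fun b hb => hF T' b ?_) (hF _ _ ?_)
  · rw [hcard]
    omega
  · have := hβ (show c + 1 ≤ T.card from hct)
    rw [Finset.card_insert_of_notMem hlast, hcard, Finset.sum_range_succ]
    omega

variable [Fintype ι]

theorem card_filter_col_mem_le (hβ : Antitone β) (e : ι ≃ Cell β) (S : Finset ℕ) :
    (Finset.univ.filter fun i => (e i).1.1 ∈ S).card ≤ ∑ c ∈ Finset.range S.card, β c := by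
  refine le_trans ?_ (sum_le_sum_range_card_of_antitone hβ S)
  rw [Finset.card_eq_sum_card_fiberwise (f := fun i => (e i).1.1) (t := S) (by
    intro i hi
    simpa using hi)]
  refine Finset.sum_le_sum fun c _ => ?_
  rw [← Fintype.card_fin (β c), Fintype.card_congr (columnEquiv e c), Fintype.card_subtype]
  exact Finset.card_le_card (Finset.filter_subset_filter _ (Finset.filter_subset _ _))

variable [DecidableEq ι]

/-- The functionals attached to the numberings of the diagram `β`. -/
def fillingFunctionals (R ι : Type*) [CommRing R] [Fintype ι] [DecidableEq ι] (β : ℕ → ℕ) :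
    Set (Module.Dual R (MvPolynomial ι R)) :=
  {F | ∃ (e : ι ≃ Cell β) (a : ι → ℕ), F = fillingFunctional R e a}

theorem span_fillingFunctionals_le_map_lastCoeff (hj : j < β c) :
    Submodule.span R (fillingFunctionals R (Fin n) (removeCell β c)) ≤
      (Submodule.span R (fillingFunctionals R (Fin (n + 1)) β) ⊓
        idealAnnihilator R (Ideal.span {X (Fin.last n) ^ (j + 1)})).map (lastCoeff R n j) := by
  rw [Submodule.span_le]
  rintro _ ⟨e, a, rfl⟩
  refine ⟨fillingFunctional R (snocCell (Nat.zero_lt_of_lt hj) e)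
    (Fin.snoc a (β c - 1 - j) : Fin (n + 1) → ℕ), ⟨Submodule.subset_span ⟨_, _, rfl⟩, ?_⟩, ?_⟩
  · rw [SetLike.mem_coe, mem_idealAnnihilator_span_iff, Set.singleton_subset_iff]
    refine X_pow_mem_annIdeal_fillingFunctional _ _ ?_
    rw [snocCell_last, Fin.snoc_last]
    change β c ≤ _
    omega
  · exact LinearMap.ext fun g => fillingFunctional_snocCell hj e a g

variable [IsDomain R] [Infinite R]

theorem fillingFunctional_mem_idealAnnihilator_tanisakiIdeal (hβ : Antitone β) (e : ι ≃ Cell β)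
    (a : ι → ℕ) : fillingFunctional R e a ∈ idealAnnihilator R (tanisakiIdeal R ι β) := by
  rw [mem_idealAnnihilator_tanisakiIdeal]
  intro T r hr
  let S := T.image fun i => (e i).1.1
  refine hsymmOn_mem_annIdeal_of_invariant (U := Finset.univ.filter fun i => (e i).1.1 ∈ S)
    (fun i hi => ?_) (fillingFunctional_mul_prod_one_sub e a S) (lt_of_le_of_lt ?_ hr)
  · rw [Finset.mem_filter]
    exact ⟨Finset.mem_univ i, Finset.mem_image_of_mem _ hi⟩
  · exact (card_filter_col_mem_le hβ e S).trans
      (Finset.sum_le_sum_of_subset (Finset.range_subset_range.mpr Finset.card_image_le))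

theorem span_fillingFunctionals_le (hβ : Antitone β) :
    Submodule.span R (fillingFunctionals R ι β) ≤ idealAnnihilator R (tanisakiIdeal R ι β) := by
  rw [Submodule.span_le]
  rintro _ ⟨e, a, rfl⟩
  exact fillingFunctional_mem_idealAnnihilator_tanisakiIdeal hβ e a

theorem mem_span_fillingFunctionals_of_X_last_pow_mem [Finite (Cell β)] (hβ : Antitone β)
    (ih : ∀ c, β (c + 1) < β c → idealAnnihilator R (tanisakiIdeal R (Fin n) (removeCell β c)) ≤
      Submodule.span R (fillingFunctionals R (Fin n) (removeCell β c)))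
    {J : ℕ} (hJ : J ≤ β 0) {F : Module.Dual R (MvPolynomial (Fin (n + 1)) R)}
    (hF : F ∈ idealAnnihilator R (tanisakiIdeal R (Fin (n + 1)) β))
    (hFJ : X (Fin.last n) ^ J ∈ annIdeal F) :
    F ∈ Submodule.span R (fillingFunctionals R (Fin (n + 1)) β) := by
  induction J generalizing F with
  | zero =>
    have : F = 0 := LinearMap.ext fun g => by simpa using hFJ g
    exact this ▸ zero_mem _
  | succ j ihj =>
    obtain ⟨c, hc, hc'⟩ := exists_column_eq_last (β := β) (j := j) hJ
    obtain ⟨G, ⟨hG, hGj⟩, hGF⟩ := span_fillingFunctionals_le_map_lastCoeff hc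
      (ih c (by omega) (lastCoeff_mem_idealAnnihilator_tanisakiIdeal hβ hc hc' hF hFJ))
    rw [SetLike.mem_coe, mem_idealAnnihilator_span_iff, Set.singleton_subset_iff] at hGj
    have hsub : F - G ∈ Submodule.span R (fillingFunctionals R (Fin (n + 1)) β) := by
      refine ihj (by omega) (sub_mem hF (span_fillingFunctionals_le hβ hG))
        (X_last_pow_mem_annIdeal_of_lastCoeff_eq_zero (fun g => ?_) ?_)
      · rw [LinearMap.sub_apply, hFJ, hGj, sub_zero]
      · rw [map_sub, hGF, sub_self]
    simpa using add_mem hsub hG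

theorem idealAnnihilator_tanisakiIdeal (hβ : Antitone β) (e : Fin n ≃ Cell β) :
    idealAnnihilator R (tanisakiIdeal R (Fin n) β) =
      Submodule.span R (fillingFunctionals R (Fin n) β) := by
  refine le_antisymm ?_ (span_fillingFunctionals_le hβ)
  induction n generalizing β with
  | zero =>
    intro F _
    have : F = F 1 • fillingFunctional R e Fin.elim0 := by
      refine linearMap_ext_prod_aeval fun p => ?_
      rw [LinearMap.smul_apply, fillingFunctional_prod_aeval]
      simp
    rw [this]
    exact Submodule.smul_mem _ _ (Submodule.subset_span ⟨_, _, rfl⟩)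
  | succ n ih =>
    intro F hF
    have : Finite (Cell β) := Finite.of_equiv _ e
    refine mem_span_fillingFunctionals_of_X_last_pow_mem hβ (fun c hc => ?_) le_rfl hF ?_
    · exact ih (antitone_removeCell hβ hc) (removeCellEquiv (Nat.zero_lt_of_lt hc) e)
    · rw [← hsymmOn_singleton]
      exact mem_idealAnnihilator_tanisakiIdeal.mp hF _ _ (by simp)

end Tanisaki

section Pairing

variable {σ τ I R : Type*} [CommRing R]

/-- The apolar pairing `⟨P, Q⟩`, the value at the origin of `Q(∂)P`. It is encoded by its values
`m! · coeff m P` on the monomials `Q = X ^ m`. -/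
def pairing : MvPolynomial σ R →ₗ[R] Module.Dual R (MvPolynomial σ R) :=
  ((basisMonomials σ R).constr R fun m => (m.prod fun _ k => (k ! : R)) • lcoeff R m).flip

theorem pairing_monomial (P : MvPolynomial σ R) (m : σ →₀ ℕ) (c : R) :
    pairing P (monomial m c) = c * ((m.prod fun _ k => (k ! : R)) * coeff m P) := by
  have h := (basisMonomials σ R).constr_basis R
    (fun m => (m.prod fun _ k => (k ! : R)) • lcoeff R m) m
  rw [coe_basisMonomials] at h
  rw [← mul_one c, ← smul_eq_mul, ← smul_monomial, map_smul, pairing, LinearMap.flip_apply, h]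
  simp [lcoeff]

theorem pairing_C (P : MvPolynomial σ R) (c : R) : pairing P (C c) = c * constantCoeff P := by
  rw [C_apply, pairing_monomial, Finsupp.prod_zero_index, one_mul, constantCoeff_eq]

theorem prod_factorial_add_single (m : σ →₀ ℕ) (u : σ) :
    ((m + Finsupp.single u 1).prod fun _ k => k !) = (m u + 1) * m.prod fun _ k => k ! := by
  classical
  have hsupp : (m + Finsupp.single u 1).support ⊆ insert u m.support := by
    refine Finsupp.support_add.trans (Finset.union_subset (Finset.subset_insert _ _) ?_)
    exact Finsupp.support_single_subset.trans (by simp)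
  rw [Finsupp.prod_of_support_subset _ hsupp _ (fun _ _ => rfl),
    Finsupp.prod_of_support_subset m (Finset.subset_insert u _) _ (fun _ _ => rfl),
    ← Finset.mul_prod_erase _ _ (Finset.mem_insert_self u _),
    ← Finset.mul_prod_erase _ _ (Finset.mem_insert_self u _), Finsupp.add_apply,
    Finsupp.single_eq_same, Nat.factorial_succ, mul_assoc]
  congr 2
  refine Finset.prod_congr rfl fun i hi => ?_
  rw [Finsupp.add_apply, Finsupp.single_eq_of_ne (Finset.ne_of_mem_erase hi), add_zero]

theorem pairing_X_mul (P Q : MvPolynomial σ R) (u : σ) :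
    pairing P (X u * Q) = pairing (pderiv u P) Q := by
  induction Q using MvPolynomial.induction_on' with
  | monomial m c =>
    rw [mul_comm, X, monomial_mul, pairing_monomial, pairing_monomial, coeff_pderiv, mul_one]
    have h := congrArg (Nat.cast (R := R)) (prod_factorial_add_single m u)
    simp only [Finsupp.prod, Nat.cast_prod, Nat.cast_mul, Nat.cast_add, Nat.cast_one] at h ⊢
    rw [h]
    ring
  | add p q hp hq => rw [mul_add, map_add, map_add, hp, hq]

theorem pderiv_aeval_of_pderiv_eq_C {L : σ → MvPolynomial τ R} {v : τ} {M : σ →₀ R}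
    (hL : ∀ u, pderiv v (L u) = C (M u)) (P : MvPolynomial σ R) :
    pderiv v (aeval L P) =
      aeval L (Finsupp.linearCombination R (fun u => pderiv u P) M) := by
  simp only [Finsupp.linearCombination_apply, Finsupp.sum]
  induction P using MvPolynomial.induction_on with
  | C a => simp
  | add p q hp hq => simp only [map_add, hp, hq, smul_add, Finset.sum_add_distrib]
  | mul_X p u hp =>
    classical
    have hu : ∑ i ∈ M.support, M i • pderiv i (X u : MvPolynomial σ R) = C (M u) := by
      simp only [pderiv_X, Pi.single_apply, smul_ite, smul_zero, Finset.sum_ite_eq,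
        Finsupp.mem_support_iff, smul_eq_C_mul, mul_one, ite_not, ite_eq_right_iff]
      intro h
      rw [h, map_zero]
    have hmul : ∀ i, M i • pderiv i (p * X u) =
        (M i • pderiv i p) * X u + p * (M i • pderiv i (X u)) := fun i => by
      rw [pderiv_mul, smul_add, smul_mul_assoc, mul_smul_comm]
    simp only [hmul, Finset.sum_add_distrib, ← Finset.sum_mul, ← Finset.mul_sum, hu]
    simp only [map_add, map_mul, ← hp, pderiv_mul, hL, aeval_X, algHom_C, algebraMap_eq]

theorem pairing_aeval {L : σ → MvPolynomial τ R} {M : τ → σ →₀ R}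
    (hL : ∀ u v, pderiv v (L u) = C (M v u)) (hL0 : ∀ u, constantCoeff (L u) = 0)
    (P : MvPolynomial σ R) (Q : MvPolynomial τ R) :
    pairing (aeval L P) Q =
      pairing P (aeval (fun v => Finsupp.linearCombination R X (M v)) Q) := by
  induction Q using MvPolynomial.induction_on generalizing P with
  | C a =>
    have h0 : constantCoeff (aeval L P) = constantCoeff P := by
      induction P using MvPolynomial.induction_on with
      | C a => simp
      | add p q hp hq => rw [map_add, map_add, hp, hq, map_add]
      | mul_X p u _ => rw [map_mul, map_mul, aeval_X, hL0, map_mul, constantCoeff_X]; simp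
    rw [algHom_C, algebraMap_eq, pairing_C, pairing_C, h0]
  | add p q hp hq => rw [map_add, map_add, map_add, hp, hq]
  | mul_X p v hp =>
    rw [mul_comm, pairing_X_mul, pderiv_aeval_of_pderiv_eq_C fun u => hL u v, hp, map_mul, aeval_X]
    simp only [Finsupp.linearCombination_apply, Finsupp.sum, map_sum, map_smul, Finset.sum_mul,
      smul_mul_assoc, pairing_X_mul, LinearMap.sum_apply, LinearMap.smul_apply]

theorem factorial_smul_rename_eq_sum_pairing [Fintype I] {f : I → σ} (hf : Function.Injective f)
    {d : ℕ} {P : MvPolynomial I R} (hP : P.IsHomogeneous d) :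
    d ! • rename f P = ∑ u : Fin d → I,
      pairing (rename f P) (∏ b, X (f (u b))) • ∏ b, X (f (u b)) := by
  induction d generalizing P with
  | zero =>
    obtain ⟨c, rfl⟩ : ∃ c, P = C c :=
      ⟨_, totalDegree_eq_zero_iff_eq_C.mp ((totalDegree_zero_iff_isHomogeneous I).mpr hP)⟩
    have h := pairing_C (σ := σ) (C c) (1 : R)
    simp_all [smul_eq_C_mul]
  | succ d ih =>
    rw [← (Fin.consEquiv fun _ => I).sum_comp, Fintype.sum_prod_type, Nat.factorial_succ, mul_comm,
      mul_smul, ← map_nsmul, ← hP.sum_X_mul_pderiv, map_sum, Finset.smul_sum]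
    refine Finset.sum_congr rfl fun v _ => ?_
    rw [map_mul, rename_X, ← mul_smul_comm, ih (by simpa using hP.pderiv), Finset.mul_sum]
    refine Finset.sum_congr rfl fun u _ => ?_
    simp only [Fin.consEquiv_apply, Fin.prod_univ_succ, Fin.cons_zero, Fin.cons_succ,
      pairing_X_mul, pderiv_rename hf, mul_smul_comm]

end Pairing

section ShiftedWronskian

theorem derivAtZero_eq (α : ℂ⟦X⟧) (m : ℕ) : derivAtZero α m = m ! * PowerSeries.coeff m α := by
  rw [derivAtZero, ← PowerSeries.coeff_zero_eq_constantCoeff_apply,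
    PowerSeries.coeff_iterate_derivative]
  simp [Nat.one_ascFactorial]

/-- The generic series `∑ X_i^(j) T^j / j!`, with respect to which the action of `α` is the
multiplication by `α`. -/
def genericSeries (N : ℕ) (i : Fin (N + 1)) : (V N)⟦X⟧ :=
  PowerSeries.mk fun j => (j ! : ℂ)⁻¹ • X (i, j)

theorem map_act_genericSeries (N : ℕ) (α : ℂ⟦X⟧ˣ) (i : Fin (N + 1)) :
    PowerSeries.map (act N α : V N →+* V N) (genericSeries N i) =
      genericSeries N i * PowerSeries.map C (α : ℂ⟦X⟧) := by
  ext1 j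
  simp only [genericSeries, PowerSeries.coeff_map, PowerSeries.coeff_mul, PowerSeries.coeff_mk,
    Finset.Nat.sum_antidiagonal_eq_sum_range_succ_mk, RingHom.coe_coe, map_smul, act, aeval_X,
    leibniz, Finset.smul_sum, smul_smul]
  refine Finset.sum_congr rfl fun l hl => ?_
  rw [mul_comm _ (C _), ← smul_eq_C_mul, smul_smul, derivAtZero_eq,
    Nat.cast_choose ℂ (Nat.lt_succ_iff.mp (Finset.mem_range.mp hl))]
  congr 1
  have hj : (j ! : ℂ) ≠ 0 := Nat.cast_ne_zero.mpr j.factorial_ne_zero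
  have hl : (l ! : ℂ) ≠ 0 := Nat.cast_ne_zero.mpr l.factorial_ne_zero
  have hjl : ((j - l)! : ℂ) ≠ 0 := Nat.cast_ne_zero.mpr (j - l).factorial_ne_zero
  field_simp

/-- The determinant of the first `b` coefficients of the series `T ^ a i` times the generic series
of index `w i`, for `i < b`; for `a = 0` and distinct `w i` it is, up to a constant, the Wronskian
of the `X_(w i)`. -/
def shiftedWronskian (N b : ℕ) (w : Fin b → Fin (N + 1)) (a : Fin b → ℕ) : V N :=
  (coeffMatrix fun i => PowerSeries.X ^ a i * genericSeries N (w i)).det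

theorem shiftedWronskian_mem_VDiff (N b : ℕ) (w : Fin b → Fin (N + 1)) (a : Fin b → ℕ) :
    shiftedWronskian N b w a ∈ VDiff N b := by
  intro α
  have h := RingHom.map_det (act N α : V N →+* V N)
    (coeffMatrix fun i => PowerSeries.X ^ a i * genericSeries N (w i))
  rw [map_coeffMatrix] at h
  simp only [map_mul, map_pow, PowerSeries.map_X, map_act_genericSeries, ← mul_assoc,
    det_coeffMatrix_mul] at h
  refine h.trans ?_
  rw [mul_comm, smul_eq_C_mul, map_pow, ← PowerSeries.coeff_zero_eq_constantCoeff_apply,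
    PowerSeries.coeff_map, PowerSeries.coeff_zero_eq_constantCoeff_apply, shiftedWronskian]

theorem shiftedWronskian_mem_orderLE (N b : ℕ) (w : Fin b → Fin (N + 1)) (a : Fin b → ℕ) :
    shiftedWronskian N b w a ∈ orderLE N ((b : ℤ) - 1) := by
  rw [shiftedWronskian, Matrix.det_apply]
  refine sum_mem fun σ _ => zsmul_mem (prod_mem fun i _ => ?_) _
  rw [coeffMatrix, Matrix.of_apply, PowerSeries.coeff_X_pow_mul']
  split_ifs
  · rw [genericSeries, PowerSeries.coeff_mk]
    refine Subalgebra.smul_mem _ (X_mem_supported.mpr ?_) _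
    have := i.isLt
    simp only [Set.mem_ofPred_eq]
    omega
  · exact zero_mem _

theorem shiftedWronskian_mem_VDiffOrder (N b : ℕ) (w : Fin b → Fin (N + 1)) (a : Fin b → ℕ) :
    shiftedWronskian N b w a ∈ VDiffOrder N b ((b : ℤ) - 1) :=
  ⟨shiftedWronskian_mem_VDiff N b w a, shiftedWronskian_mem_orderLE N b w a⟩

theorem shiftedWronskian_eq_zero {N b : ℕ} {w : Fin b → Fin (N + 1)} {a : Fin b → ℕ} {i : Fin b}
    (hi : b ≤ a i) : shiftedWronskian N b w a = 0 := by
  refine Matrix.det_eq_zero_of_row_eq_zero i fun j => ?_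
  rw [coeffMatrix, Matrix.of_apply, PowerSeries.coeff_X_pow_mul', if_neg]
  exact not_le.mpr (j.isLt.trans_le hi)

/-- The shifted Wronskians of size at most `k + 1`. -/
def shiftedWronskians (N k : ℕ) : Set (V N) :=
  {P | ∃ b ≤ k + 1, ∃ w a, P = shiftedWronskian N b w a}

theorem shiftedWronskians_finite (N k : ℕ) : (shiftedWronskians N k).Finite := by
  refine Set.Finite.subset ((Set.finite_range fun p : Σ b : Fin (k + 2),
    (Fin b → Fin (N + 1)) × (Fin b → Fin (k + 1)) =>
      shiftedWronskian N p.1 p.2.1 fun i => p.2.2 i).union (Set.finite_singleton 0)) ?_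
  rintro _ ⟨b, hb, w, a, rfl⟩
  by_cases! h : ∃ i, b ≤ a i
  · obtain ⟨i, hi⟩ := h
    exact Or.inr (shiftedWronskian_eq_zero hi)
  · exact Or.inl ⟨⟨⟨b, by omega⟩, w, fun i => ⟨a i, (h i).trans_le hb⟩⟩, rfl⟩

theorem det_blockMatrix_mem_adjoin_shiftedWronskians {N k : ℕ} {ι : Type*} [Fintype ι]
    [DecidableEq ι] {β : ℕ → ℕ} (hβ : ∀ c, β c ≤ k + 1) (e : ι ≃ Cell β) (w : ι → Fin (N + 1))
    (a : ι → ℕ) :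
    (blockMatrix e fun i => PowerSeries.X ^ a i * genericSeries N (w i)).det ∈
      Algebra.adjoin ℂ (shiftedWronskians N k) := by
  rw [det_blockMatrix]
  exact prod_mem fun c _ => Algebra.subset_adjoin ⟨β c, hβ c, _, _, rfl⟩

end ShiftedWronskian

section Invariance

variable {N : ℕ}

theorem coeff_aeval_C_mul_X {σ R : Type*} [CommRing R] (t : R) (P : MvPolynomial σ R)
    (m : σ →₀ ℕ) : coeff m (aeval (fun i => C t * X i) P) = t ^ m.degree * coeff m P := by
  classical
  induction P using MvPolynomial.induction_on' with
  | monomial l c =>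
    have h : aeval (fun i => C t * X i) (monomial l c) = C (t ^ l.degree) * monomial l c := by
      rw [aeval_monomial, monomial_eq, Finsupp.prod, Finsupp.prod]
      simp only [mul_pow, Finset.prod_mul_distrib, Finset.prod_pow_eq_pow_sum, Finsupp.degree_apply,
        map_pow, algebraMap_eq]
      ring
    rw [h, coeff_C_mul, coeff_monomial]
    split_ifs with hlm
    · rw [hlm]
    · rw [mul_zero, mul_zero]
  | add p q hp hq => rw [map_add, coeff_add, hp, hq, coeff_add, mul_add]

/-- The constant series `t`, as an invertible series. -/
def constUnit (t : ℂˣ) : ℂ⟦X⟧ˣ :=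
  Units.map (PowerSeries.C (R := ℂ)).toMonoidHom t

theorem act_constUnit (t : ℂˣ) : act N (constUnit t) = aeval fun p => C (t : ℂ) * X p := by
  refine congrArg aeval (funext fun p => ?_)
  have ht : (constUnit t : ℂ⟦X⟧) = PowerSeries.C (t : ℂ) := rfl
  rw [leibniz, Finset.sum_range_succ, Finset.sum_eq_zero, zero_add, derivAtZero_eq, ht]
  · simp [smul_eq_C_mul]
  · intro j hj
    have hne : p.2 - j ≠ 0 := Nat.sub_ne_zero_of_lt (Finset.mem_range.mp hj)
    rw [derivAtZero_eq, ht, PowerSeries.coeff_C, if_neg hne, mul_zero, mul_zero, zero_smul]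

theorem isHomogeneous_of_mem_VDiff {d : ℕ} {P : V N} (hP : P ∈ VDiff N d) : P.IsHomogeneous d := by
  intro m hm
  let t : ℂˣ := Units.mk0 2 two_ne_zero
  have ht : PowerSeries.constantCoeff (constUnit t : ℂ⟦X⟧) = 2 := PowerSeries.constantCoeff_C _
  have h := coeff_aeval_C_mul_X (t : ℂ) P m
  rw [← act_constUnit, hP, coeff_smul, smul_eq_mul, ht, Units.val_mk0] at h
  have hpow : (2 : ℕ) ^ d = 2 ^ m.degree := by exact_mod_cast mul_right_cancel₀ hm h
  refine (DFunLike.congr_fun Finsupp.degree_eq_weight_one m).symm.trans ?_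
  exact (Nat.pow_right_injective le_rfl hpow).symm

/-- The invertible series `1 - zT`. -/
def oneSub (z : ℂ) : ℂ⟦X⟧ˣ :=
  Units.mkOfMulEqOne (1 - PowerSeries.C z * PowerSeries.X) (PowerSeries.mk (z ^ ·))
    (by rw [mul_comm, mk_pow_mul_one_sub])

theorem coe_oneSub (z : ℂ) : (oneSub z : ℂ⟦X⟧) = 1 - PowerSeries.C z * PowerSeries.X := rfl

theorem constantCoeff_oneSub (z : ℂ) : PowerSeries.constantCoeff (oneSub z : ℂ⟦X⟧) = 1 := by
  simp [coe_oneSub]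

theorem leibniz_oneSub (z : ℂ) (i : Fin (N + 1)) (j : ℕ) :
    leibniz N (oneSub z : ℂ⟦X⟧) i j = X (i, j) - (j * z) • X (i, j - 1) := by
  have h0 : derivAtZero (oneSub z : ℂ⟦X⟧) 0 = 1 := by simp [derivAtZero_eq, coe_oneSub]
  have h1 : derivAtZero (oneSub z : ℂ⟦X⟧) 1 = -z := by
    simp [derivAtZero_eq, coe_oneSub, PowerSeries.coeff_one]
  have h2 : ∀ m, derivAtZero (oneSub z : ℂ⟦X⟧) (m + 2) = 0 := fun m => by
    simp [derivAtZero_eq, coe_oneSub, PowerSeries.coeff_one]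
  rw [leibniz, ← Finset.sum_range_reflect]
  simp only [Nat.add_sub_cancel]
  rcases j with _ | j
  · simp [h0]
  rw [Finset.sum_range_succ', Finset.sum_range_succ', Finset.sum_eq_zero]
  · simp [h0, h1, sub_eq_neg_add]
  · intro l hl
    have hm : j + 1 - (j + 1 - (l + 1 + 1)) = l + 2 := by
      have := Finset.mem_range.mp hl
      omega
    rw [hm, h2, mul_zero, zero_smul]

/-- The transpose, for the apolar pairing, of the action of `1 - zT`. -/
def actTranspose (N : ℕ) (z : ℂ) : V N →ₐ[ℂ] V N :=
  aeval fun p => X p - ((p.2 + 1) * z) • X (p.1, p.2 + 1)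

theorem pairing_act_oneSub (z : ℂ) (P Q : V N) :
    pairing (act N (oneSub z) P) Q = pairing P (actTranspose N z Q) := by
  classical
  let M : Fin (N + 1) × ℕ → Fin (N + 1) × ℕ →₀ ℂ := fun p =>
    Finsupp.single p 1 - Finsupp.single (p.1, p.2 + 1) ((p.2 + 1) * z)
  have hM : ∀ p, Finsupp.linearCombination ℂ X (M p) =
      (X p - ((p.2 + 1) * z) • X (p.1, p.2 + 1) : V N) := fun p => by
    simp only [M, map_sub, Finsupp.linearCombination_single, one_smul]
  rw [act, pairing_aeval (M := M), actTranspose]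
  · simp only [hM]
  · rintro ⟨i, j⟩ ⟨i', j'⟩
    simp only [leibniz_oneSub, map_sub, Derivation.map_smul, pderiv_X, M, Finsupp.sub_apply,
      Pi.single_apply, Finsupp.single_apply, Prod.mk.injEq, eq_comm (a := i'), eq_comm (a := j')]
    rcases j with _ | j
    · simp
    · by_cases h : i = i' ∧ j = j'
      · simp [h, smul_eq_C_mul]
      · have h' : ¬(i = i' ∧ j' = j) := fun h' => h ⟨h'.1, h'.2.symm⟩
        simp [h, h']
  · rintro ⟨i, j⟩
    simp [leibniz_oneSub, smul_eq_C_mul]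

end Invariance

section Umbral

variable {N d : ℕ}

/-- The umbral map `T ^ j ↦ j! X_i^(j)`, the factor `j!` being the one that makes it intertwine the
multiplication by `1 - zT` with the transposed action of that series. -/
def umbral (N : ℕ) (i : Fin (N + 1)) : ℂ[X] →ₗ[ℂ] V N :=
  (Polynomial.basisMonomials ℂ).constr ℂ fun j => (j ! : ℂ) • X (i, j)

theorem umbral_X_pow (i : Fin (N + 1)) (j : ℕ) :
    umbral N i (Polynomial.X ^ j) = (j ! : ℂ) • X (i, j) := by
  have h := (Polynomial.basisMonomials ℂ).constr_basis ℂ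
    (fun j => ((j ! : ℂ) • X (i, j) : V N)) j
  simpa only [Polynomial.coe_basisMonomials, Polynomial.monomial_one_right_eq_X_pow, umbral]
    using h

theorem actTranspose_umbral (z : ℂ) (i : Fin (N + 1)) (p : ℂ[X]) :
    actTranspose N z (umbral N i p) =
      umbral N i (p * (1 - Polynomial.C z * Polynomial.X)) := by
  suffices h : (actTranspose N z).toLinearMap ∘ₗ umbral N i =
      umbral N i ∘ₗ LinearMap.mulRight ℂ (1 - Polynomial.C z * Polynomial.X) from
    LinearMap.congr_fun h p
  refine (Polynomial.basisMonomials ℂ).ext fun j => ?_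
  have hj : (Polynomial.X ^ j * (1 - Polynomial.C z * Polynomial.X) : ℂ[X]) =
      Polynomial.X ^ j - z • Polynomial.X ^ (j + 1) := by
    rw [Polynomial.smul_eq_C_mul]
    ring
  simp only [Polynomial.coe_basisMonomials, Polynomial.monomial_one_right_eq_X_pow,
    LinearMap.comp_apply, LinearMap.mulRight_apply, hj, map_sub, map_smul, umbral_X_pow,
    AlgHom.toLinearMap_apply, actTranspose, aeval_X, smul_sub, smul_smul, Nat.factorial_succ,
    Nat.cast_mul, Nat.cast_succ]
  congr 2
  ring

/-- The umbral map along a word: `∏ x_b ^ (m b) ↦ ∏ (m b)! X_(w b)^(m b)`. -/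
def umbralProd (w : Fin d → Fin (N + 1)) : MvPolynomial (Fin d) ℂ →ₗ[ℂ] V N :=
  ofMultilinear <| (MultilinearMap.mkPiAlgebra ℂ (Fin d) (V N)).compLinearMap fun b =>
    umbral N (w b)

theorem umbralProd_prod_aeval (w : Fin d → Fin (N + 1)) (p : Fin d → ℂ[X]) :
    umbralProd w (∏ b, Polynomial.aeval (X b) (p b)) = ∏ b, umbral N (w b) (p b) :=
  ofMultilinear_prod_aeval _ p

theorem umbralProd_mul_prod_one_sub (w : Fin d → Fin (N + 1)) (z : ℂ)
    (g : MvPolynomial (Fin d) ℂ) :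
    umbralProd w (g * ∏ b, (1 - C z * X b)) = actTranspose N z (umbralProd w g) := by
  suffices h : umbralProd w ∘ₗ LinearMap.mulRight ℂ (∏ b, (1 - C z * X b)) =
      (actTranspose N z).toLinearMap ∘ₗ umbralProd w from LinearMap.congr_fun h g
  refine linearMap_ext_prod_aeval fun p => ?_
  have hz : ∀ b, (1 - C z * X b : MvPolynomial (Fin d) ℂ) =
      Polynomial.aeval (X b) (1 - Polynomial.C z * Polynomial.X) := fun b => by
    simp [algebraMap_eq]
  simp only [LinearMap.comp_apply, LinearMap.mulRight_apply, hz, ← Finset.prod_mul_distrib,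
    ← map_mul, umbralProd_prod_aeval, AlgHom.toLinearMap_apply, map_prod, actTranspose_umbral]

theorem pderiv_eq_zero_of_mem_orderLE {k : ℤ} {P : V N} (hP : P ∈ orderLE N k)
    (i : Fin (N + 1)) {j : ℕ} (hj : k < j) : pderiv (i, j) P = 0 :=
  pderiv_eq_zero_of_notMem_vars fun h =>
    hj.not_ge (mem_supported.mp hP (Finset.mem_coe.mpr h))

theorem pairing_umbral_mul_eq_zero {k : ℕ} {P : V N} (hP : P ∈ orderLE N k) (i : Fin (N + 1))
    (p : ℂ[X]) (Q : V N) : pairing P (umbral N i (p * Polynomial.X ^ (k + 1)) * Q) = 0 := by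
  suffices h : pairing P ∘ₗ LinearMap.mulRight ℂ Q ∘ₗ umbral N i ∘ₗ
      LinearMap.mulRight ℂ (Polynomial.X ^ (k + 1)) = 0 from LinearMap.congr_fun h p
  refine (Polynomial.basisMonomials ℂ).ext fun j => ?_
  simp only [Polynomial.coe_basisMonomials, Polynomial.monomial_one_right_eq_X_pow,
    LinearMap.comp_apply, LinearMap.mulRight_apply, ← pow_add, umbral_X_pow, map_smul,
    pairing_X_mul, LinearMap.zero_apply]
  rw [pderiv_eq_zero_of_mem_orderLE hP i (by omega), map_zero, LinearMap.zero_apply, smul_zero]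

/-- The polarisation of `P` along the word `w`, as a functional on polynomials in one variable
`x_b` for each letter of the word. -/
def polarization (P : V N) (w : Fin d → Fin (N + 1)) : Module.Dual ℂ (MvPolynomial (Fin d) ℂ) :=
  pairing P ∘ₗ umbralProd w

theorem X_pow_mem_annIdeal_polarization {k : ℕ} {P : V N} (hP : P ∈ orderLE N k)
    (w : Fin d → Fin (N + 1)) (l : Fin d) : X l ^ (k + 1) ∈ annIdeal (polarization P w) := by
  rw [mem_annIdeal]
  suffices h : polarization P w ∘ₗ LinearMap.mulRight ℂ (X l ^ (k + 1)) = 0 from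
    LinearMap.congr_fun h
  refine linearMap_ext_prod_aeval fun p => ?_
  have hl : (X l ^ (k + 1) : MvPolynomial (Fin d) ℂ) = ∏ b, Polynomial.aeval (X b)
      ((Pi.mulSingle l (Polynomial.X ^ (k + 1)) : Fin d → ℂ[X]) b) := by
    rw [prod_aeval_mulSingle, map_pow, Polynomial.aeval_X]
  rw [LinearMap.comp_apply, LinearMap.mulRight_apply, hl, ← Finset.prod_mul_distrib]
  simp only [← map_mul, polarization, LinearMap.comp_apply, umbralProd_prod_aeval]
  rw [← Finset.mul_prod_erase _ _ (Finset.mem_univ l), Pi.mulSingle_eq_same,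
    pairing_umbral_mul_eq_zero hP, LinearMap.zero_apply]

theorem polarization_mul_prod_one_sub {P : V N} (hP : P ∈ VDiff N d) (w : Fin d → Fin (N + 1))
    (z : ℂ) (g : MvPolynomial (Fin d) ℂ) :
    polarization P w (g * ∏ b, (1 - C z * X b)) = polarization P w g := by
  rw [polarization, LinearMap.comp_apply, umbralProd_mul_prod_one_sub, ← pairing_act_oneSub,
    hP (oneSub z), constantCoeff_oneSub, one_pow, one_smul, LinearMap.comp_apply]

end Umbral

section Contraction

variable {R ι A : Type*} [CommRing R] [Fintype ι] [DecidableEq ι] [CommRing A] [Algebra R A]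

/-- The result of evaluating a functional of `(x_i)` on the product of the truncated series
`∑_{m ≤ k} (coeff m (G i)) x_i ^ m`. -/
def contract (k : ℕ) (G : ι → A⟦X⟧) : Module.Dual R (MvPolynomial ι R) →ₗ[R] A :=
  ∑ m : ι → Fin (k + 1),
    (LinearMap.applyₗ (∏ i, X i ^ (m i : ℕ))).smulRight (∏ i, PowerSeries.coeff (m i : ℕ) (G i))

theorem contract_apply (k : ℕ) (G : ι → A⟦X⟧) (F : Module.Dual R (MvPolynomial ι R)) :
    contract k G F = ∑ m : ι → Fin (k + 1),
      F (∏ i, X i ^ (m i : ℕ)) • ∏ i, PowerSeries.coeff (m i : ℕ) (G i) := by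
  simp [contract]

variable {β : ℕ → ℕ}

theorem algebraMap_fillingFunctional (e : ι ≃ Cell β) (a m : ι → ℕ) :
    algebraMap R A (fillingFunctional R e a (∏ i, X i ^ m i)) =
      fillingFunctional A e a (∏ i, X i ^ m i) := by
  rw [prod_X_pow_eq_prod_aeval, prod_X_pow_eq_prod_aeval, fillingFunctional_prod_aeval,
    fillingFunctional_prod_aeval, RingHom.map_det, map_blockMatrix]
  simp

theorem contract_fillingFunctional {k : ℕ} (hβ : ∀ c, β c ≤ k + 1) (e : ι ≃ Cell β)
    (a : ι → ℕ) (G : ι → A⟦X⟧) :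
    contract k G (fillingFunctional R e a) =
      (blockMatrix e fun i => PowerSeries.X ^ a i * G i).det := by
  have htrunc : (blockMatrix e fun i => PowerSeries.X ^ a i * G i) =
      blockMatrix e fun i => PowerSeries.X ^ a i * (PowerSeries.trunc (k + 1) (G i) : A⟦X⟧) := by
    ext1 i j
    have hj := (e j).2.trans_le (hβ _)
    simp only [blockMatrix_apply, PowerSeries.coeff_X_pow_mul']
    rw [PowerSeries.coeff_coe_trunc_of_lt ((Nat.sub_le _ _).trans_lt hj)]
  have hprod : ∏ i, Polynomial.aeval (X i : MvPolynomial ι A) (PowerSeries.trunc (k + 1) (G i)) =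
      ∑ m : ι → Fin (k + 1), (∏ i, PowerSeries.coeff (m i : ℕ) (G i)) •
        ∏ i, X i ^ (m i : ℕ) := by
    simp only [PowerSeries.trunc_apply, ← Finset.range_eq_Ico, Finset.sum_range, map_sum,
      Polynomial.aeval_monomial, Finset.prod_univ_sum, Fintype.piFinset_univ,
      Finset.prod_mul_distrib, algebraMap_eq, smul_eq_C_mul, map_prod]
  rw [htrunc, ← fillingFunctional_prod_aeval, hprod, map_sum, contract_apply]
  refine Finset.sum_congr rfl fun m _ => ?_
  rw [map_smul, Algebra.smul_def, algebraMap_fillingFunctional, mul_comm, smul_eq_mul]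

end Contraction

section Synthesis

variable {N d : ℕ}

theorem polarization_prod_X_pow (P : V N) (w : Fin d → Fin (N + 1)) (m : Fin d → ℕ) :
    polarization P w (∏ b, X b ^ m b) =
      (∏ b, ((m b)! : ℂ)) * pairing P (∏ b, X (w b, m b)) := by
  rw [polarization, LinearMap.comp_apply, prod_X_pow_eq_prod_aeval, umbralProd_prod_aeval]
  simp only [umbral_X_pow, Finset.prod_smul, map_smul, smul_eq_mul]

theorem factorial_smul_eq_sum_contract {k : ℕ} {P : V N} (hP : P ∈ VDiffOrder N d k) :
    d ! • P = ∑ w : Fin d → Fin (N + 1),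
      contract k (fun b => genericSeries N (w b)) (polarization P w) := by
  let f : Fin (N + 1) × Fin (k + 1) → Fin (N + 1) × ℕ := Prod.map id Fin.val
  have hf : Function.Injective f := Function.injective_id.prodMap Fin.val_injective
  have hvars : (P.vars : Set (Fin (N + 1) × ℕ)) ⊆ Set.range f := fun p hp => by
    have hpk : (p.2 : ℤ) ≤ k := mem_supported.mp hP.2 hp
    exact ⟨(p.1, ⟨p.2, by omega⟩), rfl⟩
  obtain ⟨Q, rfl⟩ := exists_rename_eq_of_vars_subset_range P f hf hvars
  have hQ : Q.IsHomogeneous d :=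
    (IsHomogeneous.rename_isHomogeneous_iff hf).mp (isHomogeneous_of_mem_VDiff hP.1)
  rw [factorial_smul_rename_eq_sum_pairing hf hQ,
    ← (Equiv.arrowProdEquivProdArrow (Fin d) (fun _ => Fin (N + 1))
      (fun _ => Fin (k + 1))).symm.sum_comp, Fintype.sum_prod_type]
  refine Finset.sum_congr rfl fun w _ => ?_
  rw [contract_apply]
  refine Finset.sum_congr rfl fun m _ => ?_
  have hm : ∏ b, ((m b : ℕ)! : ℂ) ≠ 0 :=
    Finset.prod_ne_zero_iff.mpr fun b _ => Nat.cast_ne_zero.mpr (Nat.factorial_ne_zero _)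
  simp only [polarization_prod_X_pow, genericSeries, PowerSeries.coeff_mk, Finset.prod_smul,
    Finset.prod_inv_distrib, smul_smul]
  rw [mul_right_comm, mul_inv_cancel₀ hm, one_mul]
  rfl

end Synthesis

section ColLength

/-- The column lengths of the diagram with `d` cells all of whose nonempty columns, except possibly
the last one, have length `k + 1`. -/
def colLength (k d c : ℕ) : ℕ := min (k + 1) (d - c * (k + 1))

theorem antitone_colLength (k d : ℕ) : Antitone (colLength k d) := fun _ _ h =>
  min_le_min le_rfl (Nat.sub_le_sub_left (Nat.mul_le_mul_right (k + 1) h) d)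

theorem colLength_le (k d c : ℕ) : colLength k d c ≤ k + 1 := min_le_left _ _

theorem sum_range_colLength (k d t : ℕ) :
    ∑ c ∈ Finset.range t, colLength k d c = min (t * (k + 1)) d := by
  induction t with
  | zero => simp
  | succ t ih =>
    rw [Finset.sum_range_succ, ih, colLength, Nat.succ_mul]
    omega

/-- The filling of the diagram of column lengths `colLength k d` column by column. -/
def finEquivCellColLength (k d : ℕ) : Fin d ≃ Cell (colLength k d) where
  toFun i := ⟨(i / (k + 1), i % (k + 1)), by
    have h := Nat.div_add_mod' (i : ℕ) (k + 1)
    exact lt_min (Nat.mod_lt _ k.succ_pos) (by simp only; omega)⟩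
  invFun p := ⟨p.1.1 * (k + 1) + p.1.2, by
    have h := p.2
    simp only [colLength] at h
    omega⟩
  left_inv i := Fin.ext (Nat.div_add_mod' _ _)
  right_inv p := by
    have h := p.2.trans_le (colLength_le k d _)
    refine Subtype.ext (Prod.ext ?_ ?_)
    · simp [Nat.add_comm _ p.1.2, Nat.add_mul_div_right _ _ k.succ_pos, Nat.div_eq_of_lt h]
    · simp [Nat.add_comm _ p.1.2, Nat.add_mul_mod_self_right, Nat.mod_eq_of_lt h]

end ColLength

section Generation

variable {N d : ℕ}

theorem polarization_mem_idealAnnihilator_tanisakiIdeal {k : ℕ} {P : V N}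
    (hP : P ∈ VDiffOrder N d k) (w : Fin d → Fin (N + 1)) :
    polarization P w ∈ idealAnnihilator ℂ (tanisakiIdeal ℂ (Fin d) (colLength k d)) := by
  refine mem_idealAnnihilator_tanisakiIdeal.mpr fun T r hr => ?_
  rw [sum_range_colLength] at hr
  rcases min_lt_iff.mp hr with h | h
  · refine hsymmOn_mem_of_pow_mem (X_pow_mem_annIdeal_polarization hP.2 w) ?_
    rw [Nat.mul_succ] at h
    omega
  · exact hsymmOn_mem_annIdeal_of_invariant (Finset.subset_univ T)
      (polarization_mul_prod_one_sub hP.1 w) (by simpa using h)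

theorem contract_polarization_mem_adjoin_shiftedWronskians {k : ℕ} {P : V N}
    (hP : P ∈ VDiffOrder N d k) (w : Fin d → Fin (N + 1)) :
    contract k (fun b => genericSeries N (w b)) (polarization P w) ∈
      Algebra.adjoin ℂ (shiftedWronskians N k) := by
  have hmem := polarization_mem_idealAnnihilator_tanisakiIdeal hP w
  rw [idealAnnihilator_tanisakiIdeal (antitone_colLength k d) (finEquivCellColLength k d)] at hmem
  refine (Submodule.span_le (p := (Subalgebra.toSubmodule
    (Algebra.adjoin ℂ (shiftedWronskians N k))).comap (contract k _))).mpr ?_ hmem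
  rintro _ ⟨e, a, rfl⟩
  rw [SetLike.mem_coe, Submodule.mem_comap, contract_fillingFunctional (colLength_le k d)]
  exact det_blockMatrix_mem_adjoin_shiftedWronskians (colLength_le k d) e w a

theorem VDiffOrder_le_adjoin_shiftedWronskians (N d k : ℕ) :
    VDiffOrder N d k ≤ Subalgebra.toSubmodule (Algebra.adjoin ℂ (shiftedWronskians N k)) := by
  intro P hP
  have hmem : (d ! : ℂ) • P ∈ Subalgebra.toSubmodule
      (Algebra.adjoin ℂ (shiftedWronskians N k)) := by
    rw [Nat.cast_smul_eq_nsmul, factorial_smul_eq_sum_contract hP]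
    exact sum_mem fun w _ => contract_polarization_mem_adjoin_shiftedWronskians hP w
  exact (Submodule.smul_mem_iff _ (Nat.cast_ne_zero.mpr d.factorial_ne_zero)).mp hmem

theorem orderLE_mono {k l : ℤ} (h : k ≤ l) : orderLE N k ≤ orderLE N l :=
  supported_mono fun _ hp => le_trans hp h

theorem orderLE_eq_bot {k : ℤ} (hk : k < 0) : orderLE N k = ⊥ := by
  have h : {p : Fin (N + 1) × ℕ | (p.2 : ℤ) ≤ k} = ∅ :=
    Set.eq_empty_of_forall_notMem fun p hp => (hk.trans_le (Int.natCast_nonneg p.2)).not_ge hp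
  rw [orderLE, h, supported_empty]

theorem homogeneousComponent_mem_VDiff {P : V N} (hP : P ∈ diffAlgebra N) (d : ℕ) :
    homogeneousComponent d P ∈ VDiff N d := by
  change P ∈ ⨆ d : ℕ, VDiff N d at hP
  induction hP using Submodule.iSup_induction' with
  | mem e P hP =>
    rw [homogeneousComponent_of_mem (isHomogeneous_of_mem_VDiff hP)]
    split_ifs with h
    · exact h ▸ hP
    · exact zero_mem _
  | zero => rw [map_zero]; exact zero_mem _
  | add P Q _ _ hP hQ => rw [map_add]; exact add_mem hP hQ

theorem homogeneousComponent_mem_supported {σ R : Type*} [CommRing R] {s : Set σ}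
    {P : MvPolynomial σ R} (hP : P ∈ supported R s) (d : ℕ) :
    homogeneousComponent d P ∈ supported R s := by
  rw [supported_eq_range_rename] at hP ⊢
  obtain ⟨Q, rfl⟩ := hP
  exact ⟨homogeneousComponent d Q, rename_homogeneousComponent _ _⟩

theorem VDiffOrder_le_diffAlgebraOrder (N d : ℕ) (k : ℤ) :
    VDiffOrder N d k ≤ Subalgebra.toSubmodule (diffAlgebraOrder N k) :=
  fun _ hP => ⟨Submodule.mem_iSup_of_mem d hP.1, hP.2⟩

theorem diffAlgebraOrder_mono {k l : ℤ} (h : k ≤ l) : diffAlgebraOrder N k ≤ diffAlgebraOrder N l :=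
  inf_le_inf_left _ (orderLE_mono h)

theorem adjoin_shiftedWronskians_le {k : ℕ} {A : Subalgebra ℂ (V N)}
    (hA : ∀ b ≤ k + 1, VDiffOrder N b ((b : ℤ) - 1) ≤ Subalgebra.toSubmodule A) :
    Algebra.adjoin ℂ (shiftedWronskians N k) ≤ A := by
  refine Algebra.adjoin_le ?_
  rintro _ ⟨b, hb, w, a, rfl⟩
  exact hA b hb (shiftedWronskian_mem_VDiffOrder N b w a)

theorem diffAlgebraOrder_eq_adjoin_shiftedWronskians (N k : ℕ) :
    diffAlgebraOrder N k = Algebra.adjoin ℂ (shiftedWronskians N k) := by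
  refine le_antisymm (fun P hP => ?_) (adjoin_shiftedWronskians_le fun b hb => ?_)
  · rw [← sum_homogeneousComponent P]
    exact sum_mem fun d _ => VDiffOrder_le_adjoin_shiftedWronskians N d k
      ⟨homogeneousComponent_mem_VDiff hP.1 d, homogeneousComponent_mem_supported hP.2 d⟩
  · exact (VDiffOrder_le_diffAlgebraOrder N b _).trans (diffAlgebraOrder_mono (by omega))

theorem diffAlgebraOrder_fg (N k : ℕ) : (diffAlgebraOrder N k).FG :=
  Subalgebra.fg_def.mpr ⟨shiftedWronskians N k, shiftedWronskians_finite N k,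
    (diffAlgebraOrder_eq_adjoin_shiftedWronskians N k).symm⟩

variable {A : Subalgebra ℂ (V N)}

theorem VDiffOrder_sub_two_le {i : ℕ}
    (hA : ∀ b < i, VDiffOrder N b ((b : ℤ) - 1) ≤ Subalgebra.toSubmodule A) :
    VDiffOrder N i ((i : ℤ) - 2) ≤ Subalgebra.toSubmodule A := by
  rcases Nat.lt_or_ge i 2 with h | h
  · refine inf_le_right.trans ?_
    rw [orderLE_eq_bot (by omega)]
    exact bot_le (a := A)
  · obtain ⟨l, rfl⟩ := Nat.exists_eq_add_of_le' h
    have hl : ((l + 2 : ℕ) : ℤ) - 2 = l := by push_cast; ring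
    rw [hl]
    exact (VDiffOrder_le_adjoin_shiftedWronskians N _ l).trans
      (adjoin_shiftedWronskians_le fun b hb => hA b (by omega))

theorem diffAlgebraOrder_le_of_le_sup {k : ℕ}
    (hA : ∀ i ∈ Set.Icc 1 (k + 1), VDiffOrder N i ((i : ℤ) - 1) ≤
      VDiffOrder N i ((i : ℤ) - 2) ⊔ Subalgebra.toSubmodule A) : diffAlgebraOrder N k ≤ A := by
  rw [diffAlgebraOrder_eq_adjoin_shiftedWronskians]
  refine adjoin_shiftedWronskians_le fun i => ?_
  induction i using Nat.strong_induction_on with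
  | _ i ih =>
    intro hi
    have hlow : VDiffOrder N i ((i : ℤ) - 2) ≤ Subalgebra.toSubmodule A :=
      VDiffOrder_sub_two_le fun b hb => ih b hb (hb.le.trans hi)
    rcases Nat.eq_zero_or_pos i with rfl | hpos
    · refine inf_le_right.trans ?_
      rw [orderLE_eq_bot (by simp)]
      exact bot_le (a := A)
    · exact (hA i ⟨hpos, hi⟩).trans (sup_le hlow le_rfl)

theorem le_sup_span_of_span_mkQ_eq_top {R E ι : Type*} [Ring R] [AddCommGroup E] [Module R E]
    {W W' : Submodule R E} {b : ι → W}
    (hb : Submodule.span R (Set.range fun j => (W'.submoduleOf W).mkQ (b j)) = ⊤) :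
    W ≤ W' ⊔ Submodule.span R (Set.range fun j => (b j : E)) := by
  rw [Set.range_comp' (W'.submoduleOf W).mkQ b, Submodule.span_image,
    Submodule.map_mkQ_eq_top] at hb
  calc W = (⊤ : Submodule R W).map W.subtype := by rw [Submodule.map_top, Submodule.range_subtype]
    _ = (W'.submoduleOf W).map W.subtype ⊔
        Submodule.span R (Set.range fun j => (b j : E)) := by
      rw [← hb, Submodule.map_sup, Submodule.map_span, ← Set.range_comp]
      rfl
    _ ≤ _ := sup_le_sup_right (Submodule.map_comap_le _ _) _

end Generation

end DiffHom

end

theorem mainTheorem2_general (N k : ℕ) :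
    (DiffHom.diffAlgebraOrder N k).FG ∧
    ∀ (ι : Set.Icc 1 (k + 1) → Type*)
      (B : (i : Set.Icc 1 (k + 1)) → ι i → DiffHom.VDiffOrder N (i : ℕ) (((i : ℕ) : ℤ) - 1)),
      (∀ i : Set.Icc 1 (k + 1), Submodule.span ℂ (Set.range fun j =>
        ((DiffHom.VDiffOrder N (i : ℕ) (((i : ℕ) : ℤ) - 2)).submoduleOf
          (DiffHom.VDiffOrder N (i : ℕ) (((i : ℕ) : ℤ) - 1))).mkQ (B i j)) = ⊤) →
      DiffHom.diffAlgebraOrder N k =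
        Algebra.adjoin ℂ
          (⋃ i : Set.Icc 1 (k + 1), Set.range fun j : ι i => (B i j : DiffHom.V N)) := by
  refine ⟨DiffHom.diffAlgebraOrder_fg N k, fun ι B hB => le_antisymm ?_ (Algebra.adjoin_le ?_)⟩
  · refine DiffHom.diffAlgebraOrder_le_of_le_sup fun i hi => ?_
    refine (DiffHom.le_sup_span_of_span_mkQ_eq_top (hB ⟨i, hi⟩)).trans (sup_le_sup_left ?_ _)
    exact Submodule.span_le.mpr (Set.range_subset_iff.mpr fun j =>
      Algebra.subset_adjoin (Set.mem_iUnion.mpr ⟨⟨i, hi⟩, j, rfl⟩))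
  · refine Set.iUnion_subset fun i => Set.range_subset_iff.mpr fun j => ?_
    have hi : ((i : ℕ) : ℤ) - 1 ≤ k := by have := i.2.2; omega
    exact DiffHom.diffAlgebraOrder_mono hi (DiffHom.VDiffOrder_le_diffAlgebraOrder N _ _ (B i j).2)

theorem mainTheorem2 (N k : ℕ) :
    (DiffHom.diffAlgebraOrder N k).FG ∧
    ∀ (ι : Set.Icc 1 (k + 1) → Type*)
      (B : (i : Set.Icc 1 (k + 1)) → ι i → DiffHom.VDiffOrder N (i : ℕ) (((i : ℕ) : ℤ) - 1)),
      (∀ i : Set.Icc 1 (k + 1),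
        DiffHom.InducesBasis
          (DiffHom.VDiffOrder N (i : ℕ) (((i : ℕ) : ℤ) - 1))
          (DiffHom.VDiffOrder N (i : ℕ) (((i : ℕ) : ℤ) - 2))
          (B i)) →
      DiffHom.diffAlgebraOrder N k =
        Algebra.adjoin ℂ
          (⋃ i : Set.Icc 1 (k + 1), Set.range fun j : ι i => (B i j : DiffHom.V N)) :=
  (mainTheorem2_general N k).imp_right fun h ι B hB => h ι B fun i => (hB i).2
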